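/- Let $q$ be a power of a prime $p>2$, let $A=\mathbb{F}_q[t]$, $k=\mathbb{F}_q(t)$, and let $k_\infty=\mathbb{F}_q((1/t))$ be the completion of $k$ at infinity, with the absolute value $\left|\sum_{i\le n}a_it^i\right|_\infty=q^n$ if $a_n\neq 0$, and the additive character $$e\Big(\sum_{i\le n}a_it^i\Big)=\exp\Big(\frac{2\pi i}{p}\,\mathrm{Tr}_{\mathbb{F}_q/\mathbb{F}_p}(a_{-1})\Big).$$ Let $\alpha\in A$ be a square-free polynomial which is of odd degree or whose leading coefficient is not a square in $\mathbb{F}_q$. Let $K=k(\sqrt{\alpha})$, let $\mathbb{A}$ be the integral closure of $A$ in $K$, and let $\mathbf{Tr}:K\to k$ be the trace map. Let $|\cdot|_\infty$ also denote the extension of $|\cdot|_\infty$ from $k$ to $K$ and write $\mathbf{N}(f)=|f|_\infty^2$. Then for all integers $Q,N\ge 0$ and every family $(a_g)_{g\in\mathbb{A}}$ of complex numbers, all the sums below are finite and $$ \sum_{\substack{f\in\mathbb{A}\setminus\{0\}\\ \mathbf{N}(f)=q^Q}}\ \sum_{\substack{r\bmod f^2\\ (r,f)=1}}\Bigg|\sum_{\substack{g\in\mathbb{A}\\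 \mathbf{N}(g)\le q^N}}a_g\, e\Big(\mathbf{Tr}\Big(\frac{gr}{2\sqrt{\alpha}\,f^2}\Big)\Big)\Bigg|^2 \le C\Big(q^{3Q}+2^{(N-Q)/2}\big(q^{Q/2+N}+q^{2Q+N/2}\big)\Big)\sum_{\substack{g\in\mathbb{A}\\ \mathbf{N}(g)\le q^N}}|a_g|^2, $$ where $(r,f)=1$ means that $r$ and $f$ generate the unit ideal of $\mathbb{A}$, and the constant $C>0$ depends only on $q$ and $\deg\alpha$. -/

import Mathlib

open Polynomial

noncomputable section

namespace SquareSieve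

/-- The inclusion `F[t] → F((1/t))`. An element of `LaurentSeries F` is read as a Laurent series in
the variable `1/t`, so that its coefficient with index `i` is the coefficient of `t ^ (-i)`; in
particular `t` itself is the monomial of index `-1`. -/
def polyToKInf (F : Type*) [Field F] : F[X] →+* LaurentSeries F :=
  Polynomial.eval₂RingHom HahnSeries.C (HahnSeries.single (-1) 1)

theorem polyToKInf_coeff {F : Type*} [Field F] (f : F[X]) (n : ℕ) :
    (polyToKInf F f).coeff (-(n : ℤ)) = f.coeff n := by
  induction f using Polynomial.induction_on' with
  | add f g hf hg => rw [map_add, HahnSeries.coeff_add, hf, hg, Polynomial.coeff_add]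
  | monomial m a =>
    have h : polyToKInf F (monomial m a) = HahnSeries.single (-(m : ℤ)) a := by
      simp [polyToKInf, HahnSeries.C_apply, HahnSeries.single_pow, HahnSeries.single_mul_single]
    rw [h, HahnSeries.coeff_single, Polynomial.coeff_monomial]
    simp [eq_comm]

theorem polyToKInf_injective (F : Type*) [Field F] : Function.Injective (polyToKInf F) := by
  intro f g h
  ext n
  rw [← polyToKInf_coeff f n, ← polyToKInf_coeff g n, h]

/-- The inclusion of `k = F(t)` into its completion `k_∞ = F((1/t))` at infinity. -/
def toKInf (F : Type*) [Field F] : RatFunc F →+* LaurentSeries F :=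
  IsFractionRing.lift (A := F[X]) (polyToKInf_injective F)

/-- The absolute value on `k_∞ = F((1/t))`: `|∑_{i ≤ n} a_i t^i| = q ^ n` if `a_n ≠ 0`. -/
def absInf {F : Type*} [Field F] (x : LaurentSeries F) : ℝ :=
  open Classical in if x = 0 then 0 else (Nat.card F : ℝ) ^ (-x.order)

/-- The additive character `E(x) = exp (2πi/p · Tr x)` of the finite field `F`, where `p` is the
characteristic and `Tr : F → 𝔽_p` is the trace. -/
def charE {F : Type*} [Field F] (x : F) : ℂ :=
  letI : Algebra (ZMod (ringChar F)) F := ZMod.algebra F (ringChar F)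
  Complex.exp (2 * Real.pi * Complex.I / (ringChar F : ℂ) *
    ((Algebra.trace (ZMod (ringChar F)) F x).val : ℂ))

/-- The additive character `e(∑ a_i t^i) = E(a_{-1})` of `k_∞`. -/
def charInf {F : Type*} [Field F] (x : LaurentSeries F) : ℂ :=
  charE (x.coeff 1)

section Extension

variable {F K : Type*} [Field F] [Field K] [Algebra F[X] K]

/-- The nonzero `f` in the integral closure `𝔸` of `F[t]` in `K` with `𝐍(f) = |f|² = q ^ Q`. -/
def moduli (v : AbsoluteValue K ℝ) (Q : ℕ) : Set (integralClosure F[X] K) :=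
  {f | f ≠ 0 ∧ v (f : K) ^ 2 = (Nat.card F : ℝ) ^ Q}

/-- The set `𝐁(0, N) ∩ 𝔸` of the integers `g` with `𝐍(g) = |g|² ≤ q ^ N`. -/
def ballInt (v : AbsoluteValue K ℝ) (N : ℕ) : Set (integralClosure F[X] K) :=
  {g | v (g : K) ^ 2 ≤ (Nat.card F : ℝ) ^ N}

/-- The exponential sum `∑_{g ∈ 𝐁(0, N) ∩ 𝔸} a_g e(Tr(g r / (2 s f²)))`, where `s` is the chosen
square root of `α`. -/
def expSum [Algebra (RatFunc F) K] (v : AbsoluteValue K ℝ) (s : K) (N : ℕ)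
    (a : integralClosure F[X] K → ℂ) (f r : integralClosure F[X] K) : ℂ :=
  ∑ᶠ g ∈ ballInt v N,
    a g * charInf (toKInf F (Algebra.trace (RatFunc F) K
      ((g : K) * (r : K) / (2 * s * (f : K) ^ 2))))

/-- The left-hand side of the large sieve with square moduli. The sum over `r mod f²` runs over the
residue classes `c`, each with a representative `c.out`; neither coprimality to `f` nor the
exponential sum depends on the representative. -/
def sieveSum [Algebra (RatFunc F) K] (v : AbsoluteValue K ℝ) (s : K) (Q N : ℕ)
    (a : integralClosure F[X] K → ℂ) : ℝ :=
  ∑ᶠ f ∈ moduli v Q,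
    ∑ᶠ c ∈ {c : integralClosure F[X] K ⧸ Ideal.span {f ^ 2} | IsCoprime c.out f},
      ‖expSum v s N a f c.out‖ ^ 2

end Extension

end SquareSieve

end

/-!
For each fraction `x = r / f²` the map `g ↦ e(Tr(g x / (2 √α)))` is a character of the finite group
`𝐁(0, N) ∩ 𝔸`, so Parseval's identity bounds the sum by the largest number of pairs `(f, r)` giving
one and the same character, times `|𝐁(0, N) ∩ 𝔸| · ∑ |a_g|²`.

Put `d = deg α`. As `α` is not a square in `k_∞`, one has `|x + y √α|² = max(|x|², q ^ d |y|²)`, and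
`𝔸 = A + A √α` is essentially self-dual for `Tr(x y / (2 √α))`: two fractions give the same
character only if their difference is within `q ^ ((d - N) / 2)` of an integer of `K`. Each `f` then
occurs with few `r`, and only if `f² x₀` is near an integer, where `x₀ = r₀ / f₀²` is one of the
fractions.

For `N ≤ 2 Q` all `f` with `𝐍(f) = q ^ Q` are counted. For `N ≥ 2 Q` the squares are differenced:
with `f₁` and `f₂`, also `m = f₁² - f₂²` moves `x₀` near an integer, so that `m r₀` lies in few
residue classes modulo `f₀²`; as `r₀` is invertible there and `|m| ≤ |f₀²|`, few `m` are possible.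
A nonzero `m` determines `(f₁, f₂)` up to its divisor `f₁ - f₂`, and it has `O(2 ^ Q)` divisors: the
square of the number of ideals dividing it is at most a constant times `2 ^ deg(norm m)`, because
`(n + 1)² ≤ 2 ^ (n deg 𝔭)` as soon as `deg 𝔭 ≥ 2`, while only boundedly many primes `𝔭` have
degree one. The number of possible `f` is therefore at most the square root of the number of pairs.
-/

noncomputable section

namespace SquareSieve

section LargeSieve

variable {G : Type*} [AddCommGroup G] [Fintype G]

theorem sum_norm_sq_addChar (a : G → ℂ) :
    ∑ ψ : AddChar G ℂ, ‖∑ g, a g * ψ g‖ ^ 2 = Fintype.card G * ∑ g, ‖a g‖ ^ 2 := by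
  classical
  have expand (ψ : AddChar G ℂ) : ((‖∑ g, a g * ψ g‖ ^ 2 : ℝ) : ℂ) =
      ∑ g, ∑ k, a g * (starRingEnd ℂ) (a k) * ψ (g - k) := by
    rw [Complex.ofReal_pow, ← Complex.mul_conj', map_sum, Finset.sum_mul_sum]
    refine Finset.sum_congr rfl fun g _ => Finset.sum_congr rfl fun k _ => ?_
    rw [map_mul, sub_eq_add_neg, AddChar.map_add_eq_mul, AddChar.map_neg_eq_conj]
    ring
  have orthogonality (g : G) : ∑ k, ∑ ψ : AddChar G ℂ, a g * (starRingEnd ℂ) (a k) * ψ (g - k) =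
      Fintype.card G * (‖a g‖ ^ 2 : ℝ) := by
    simp_rw [← Finset.mul_sum, AddChar.sum_apply_eq_ite, sub_eq_zero, mul_ite, mul_zero,
      Finset.sum_ite_eq, Finset.mem_univ, if_true]
    rw [Complex.ofReal_pow, ← Complex.mul_conj', mul_comm]
  apply Complex.ofReal_injective
  rw [Complex.ofReal_sum, Finset.sum_congr rfl fun ψ _ => expand ψ, Finset.sum_comm,
    Complex.ofReal_mul, Complex.ofReal_natCast, Complex.ofReal_sum, Finset.mul_sum]
  refine Finset.sum_congr rfl fun g _ => ?_
  rw [Finset.sum_comm, orthogonality]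

theorem sum_norm_sq_le_of_ncard_fiber_le {I : Type*} [Fintype I] (ψ : I → AddChar G ℂ) {B : ℝ}
    (hB : ∀ χ, ({i | ψ i = χ}.ncard : ℝ) ≤ B) (a : G → ℂ) :
    ∑ i, ‖∑ g, a g * ψ i g‖ ^ 2 ≤ B * (Fintype.card G * ∑ g, ‖a g‖ ^ 2) := by
  classical
  rw [← sum_norm_sq_addChar, Finset.mul_sum,
    ← Finset.sum_fiberwise _ ψ fun i => ‖∑ g, a g * ψ i g‖ ^ 2]
  refine Finset.sum_le_sum fun χ _ => ?_
  calc ∑ i with ψ i = χ, ‖∑ g, a g * ψ i g‖ ^ 2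
      = ∑ i with ψ i = χ, ‖∑ g, a g * χ g‖ ^ 2 :=
        Finset.sum_congr rfl fun i hi => by rw [(Finset.mem_filter.mp hi).2]
    _ = ({i | ψ i = χ}.ncard : ℝ) * ‖∑ g, a g * χ g‖ ^ 2 := by
        rw [Finset.sum_const, nsmul_eq_mul, ← Set.ncard_coe_finset, Finset.coe_filter_univ]
    _ ≤ B * ‖∑ g, a g * χ g‖ ^ 2 := by gcongr; exact hB χ

end LargeSieve

section Counting

theorem ncard_le_mul_ncard_of_mapsTo {ι κ : Type*} {s : Set ι} {t : Set κ} (f : ι → κ)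
    (hs : s.Finite) (ht : t.Finite) (hf : Set.MapsTo f s t) (n : ℕ)
    (hn : ∀ b ∈ t, {a ∈ s | f a = b}.ncard ≤ n) : s.ncard ≤ n * t.ncard := by
  classical
  lift s to Finset ι using hs
  lift t to Finset κ using ht
  rw [Set.ncard_coe_finset, Set.ncard_coe_finset]
  refine Finset.card_le_mul_card_image_of_maps_to hf n fun b hb => ?_
  simpa [← Set.ncard_coe_finset] using hn b hb

end Counting

section Laurent

variable {F : Type*} [Field F]

theorem polyToKInf_monomial (n : ℕ) (c : F) :
    polyToKInf F (monomial n c) = HahnSeries.single (-(n : ℤ)) c := by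
  simp [polyToKInf, HahnSeries.C_apply, HahnSeries.single_pow, HahnSeries.single_mul_single]

theorem polyToKInf_coeff_of_pos (p : F[X]) {i : ℤ} (hi : 0 < i) :
    (polyToKInf F p).coeff i = 0 := by
  induction p using Polynomial.induction_on' with
  | add p r hp hr => rw [map_add, HahnSeries.coeff_add, hp, hr, add_zero]
  | monomial n c => rw [polyToKInf_monomial, HahnSeries.coeff_single_of_ne (by lia)]

theorem polyToKInf_ne_zero {p : F[X]} (hp : p ≠ 0) : polyToKInf F p ≠ 0 :=
  (map_ne_zero_iff _ (polyToKInf_injective F)).mpr hp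

theorem order_polyToKInf {p : F[X]} (hp : p ≠ 0) :
    (polyToKInf F p).order = -(p.natDegree : ℤ) := by
  apply le_antisymm
  · apply HahnSeries.order_le_of_coeff_ne_zero
    rw [polyToKInf_coeff]
    exact leadingCoeff_ne_zero.mpr hp
  · rw [HahnSeries.le_order_iff_forall (polyToKInf_ne_zero hp)]
    intro i hi
    obtain ⟨n, rfl⟩ : ∃ n : ℕ, i = -(n : ℤ) := ⟨(-i).toNat, by lia⟩
    rw [polyToKInf_coeff]
    exact coeff_eq_zero_of_natDegree_lt (by lia)

theorem leadingCoeff_polyToKInf (p : F[X]) :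
    (polyToKInf F p).leadingCoeff = p.leadingCoeff := by
  rcases eq_or_ne p 0 with rfl | hp
  · rw [map_zero, HahnSeries.leadingCoeff_zero, leadingCoeff_zero]
  · rw [HahnSeries.leadingCoeff_eq, order_polyToKInf hp, polyToKInf_coeff, coeff_natDegree]

theorem exists_coeff_sub_polyToKInf_eq_zero (x : LaurentSeries F) :
    ∃ p : F[X], ∀ i : ℤ, i ≤ 0 → (x - polyToKInf F p).coeff i = 0 := by
  refine ⟨∑ n ∈ Finset.range ((-x.order).toNat + 1), monomial n (x.coeff (-(n : ℤ))),
    fun i hi => ?_⟩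
  obtain ⟨n, rfl⟩ : ∃ n : ℕ, i = -(n : ℤ) := ⟨(-i).toNat, by lia⟩
  rw [HahnSeries.coeff_sub, polyToKInf_coeff, Polynomial.finsetSum_coeff]
  simp only [Polynomial.coeff_monomial, Finset.sum_ite_eq', Finset.mem_range]
  split_ifs with hn
  · exact sub_self _
  · rw [sub_zero]
    exact HahnSeries.coeff_eq_zero_of_lt_order (by lia)

theorem toKInf_algebraMap (p : F[X]) :
    toKInf F (algebraMap F[X] (RatFunc F) p) = polyToKInf F p :=
  IsFractionRing.lift_algebraMap _ _

theorem absInf_zero : absInf (0 : LaurentSeries F) = 0 := by simp [absInf]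

theorem absInf_of_ne_zero {x : LaurentSeries F} (hx : x ≠ 0) :
    absInf x = (Nat.card F : ℝ) ^ (-x.order) := by simp [absInf, hx]

theorem absInf_polyToKInf {p : F[X]} (hp : p ≠ 0) :
    absInf (polyToKInf F p) = (Nat.card F : ℝ) ^ p.natDegree := by
  rw [absInf_of_ne_zero (polyToKInf_ne_zero hp), order_polyToKInf hp, neg_neg, zpow_natCast]

theorem absInf_nonneg (x : LaurentSeries F) : 0 ≤ absInf x := by
  unfold absInf
  split_ifs <;> positivity

theorem absInf_neg (x : LaurentSeries F) : absInf (-x) = absInf x := by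
  rcases eq_or_ne x 0 with rfl | hx
  · rw [neg_zero]
  · rw [absInf_of_ne_zero hx, absInf_of_ne_zero (neg_ne_zero.mpr hx), HahnSeries.order_neg]

variable [Finite F]

variable (F) in
theorem one_lt_card : (1 : ℝ) < Nat.card F := by exact_mod_cast Finite.one_lt_card

theorem absInf_eq_zero {x : LaurentSeries F} : absInf x = 0 ↔ x = 0 := by
  refine ⟨fun h => by_contra fun hx => ?_, fun h => h ▸ absInf_zero⟩
  rw [absInf_of_ne_zero hx] at h
  exact zpow_ne_zero _ (one_pos.trans (one_lt_card F)).ne' h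

theorem absInf_mul (x y : LaurentSeries F) : absInf (x * y) = absInf x * absInf y := by
  rcases eq_or_ne x 0 with rfl | hx
  · simp [absInf_zero]
  rcases eq_or_ne y 0 with rfl | hy
  · simp [absInf_zero]
  rw [absInf_of_ne_zero hx, absInf_of_ne_zero hy, absInf_of_ne_zero (mul_ne_zero hx hy),
    HahnSeries.order_mul hx hy, neg_add, zpow_add₀ (one_pos.trans (one_lt_card F)).ne']

theorem absInf_sq (x : LaurentSeries F) : absInf (x ^ 2) = absInf x ^ 2 := by
  rw [pow_two, absInf_mul, pow_two]

theorem absInf_le_zpow_of_le_order {x : LaurentSeries F} {n : ℤ}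
    (h : x ≠ 0 → -n ≤ x.order) : absInf x ≤ (Nat.card F : ℝ) ^ n := by
  rcases eq_or_ne x 0 with rfl | hx
  · rw [absInf_zero]
    positivity
  · rw [absInf_of_ne_zero hx]
    exact zpow_le_zpow_right₀ (one_lt_card F).le (neg_le.mp (h hx))

theorem absInf_sub_eq_max {x y : LaurentSeries F}
    (h : x ≠ 0 → x.order = y.order → x.leadingCoeff ≠ y.leadingCoeff) :
    absInf (x - y) = max (absInf x) (absInf y) := by
  rcases eq_or_ne x 0 with rfl | hx
  · rw [zero_sub, absInf_neg, absInf_zero, max_eq_right (absInf_nonneg y)]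
  rcases eq_or_ne y 0 with rfl | hy
  · rw [sub_zero, absInf_zero, max_eq_left (absInf_nonneg x)]
  have coeff_min : (x - y).coeff (min x.order y.order) ≠ 0 := by
    rw [HahnSeries.coeff_sub]
    rcases lt_trichotomy x.order y.order with hlt | heq | hgt
    · rw [min_eq_left hlt.le, HahnSeries.coeff_eq_zero_of_lt_order hlt, sub_zero]
      exact HahnSeries.coeff_order_eq_zero.not.mpr hx
    · rw [heq, min_self, sub_ne_zero, ← HahnSeries.leadingCoeff_eq, ← heq,
        ← HahnSeries.leadingCoeff_eq]
      exact h hx heq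
    · rw [min_eq_right hgt.le, HahnSeries.coeff_eq_zero_of_lt_order hgt, zero_sub, neg_ne_zero]
      exact HahnSeries.coeff_order_eq_zero.not.mpr hy
  have hxy : x - y ≠ 0 := fun h0 => coeff_min (by rw [h0, HahnSeries.coeff_zero])
  have order_eq : (x - y).order = min x.order y.order := by
    apply le_antisymm (HahnSeries.order_le_of_coeff_ne_zero coeff_min)
    rw [HahnSeries.le_order_iff_forall hxy]
    intro i hi
    rw [lt_min_iff] at hi
    rw [HahnSeries.coeff_sub, HahnSeries.coeff_eq_zero_of_lt_order hi.1,
      HahnSeries.coeff_eq_zero_of_lt_order hi.2, sub_zero]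
  have hmono : Monotone fun n : ℤ => (Nat.card F : ℝ) ^ n := zpow_right_mono₀ (one_lt_card F).le
  rw [absInf_of_ne_zero hx, absInf_of_ne_zero hy, absInf_of_ne_zero hxy, order_eq, ← max_neg_neg,
    hmono.map_max]

theorem absInf_sq_sub_mul_sq {α : F[X]} (hα : Odd α.natDegree ∨ ¬ IsSquare α.leadingCoeff)
    (x y : LaurentSeries F) :
    absInf (x ^ 2 - polyToKInf F α * y ^ 2) =
      max (absInf x ^ 2) (absInf (polyToKInf F α) * absInf y ^ 2) := by
  rw [← absInf_sq, ← absInf_sq, ← absInf_mul]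
  refine absInf_sub_eq_max fun hx hord hlead => ?_
  rw [HahnSeries.leadingCoeff_mul, pow_two, pow_two, HahnSeries.leadingCoeff_mul,
    HahnSeries.leadingCoeff_mul, leadingCoeff_polyToKInf] at hlead
  have hx0 : x.leadingCoeff ≠ 0 :=
    HahnSeries.leadingCoeff_ne_zero.mpr (pow_ne_zero_iff two_ne_zero |>.mp hx)
  have hy0 : y.leadingCoeff ≠ 0 := by
    rintro h0
    simp [h0, hx0] at hlead
  rcases hα with hodd | hsq
  · have hα0 : α ≠ 0 := by rintro rfl; simp at hodd
    rw [HahnSeries.order_mul (polyToKInf_ne_zero hα0)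
      (pow_ne_zero 2 (HahnSeries.leadingCoeff_ne_zero.mp hy0)), HahnSeries.order_pow,
      HahnSeries.order_pow, order_polyToKInf hα0] at hord
    grind
  · refine hsq ⟨x.leadingCoeff / y.leadingCoeff, ?_⟩
    field_simp
    linear_combination -hlead

end Laurent

section Character

variable {F : Type*} [Field F]

theorem charE_eq_stdAddChar [NeZero (ringChar F)] (x : F) :
    letI : Algebra (ZMod (ringChar F)) F := ZMod.algebra F (ringChar F)
    charE x = ZMod.stdAddChar (Algebra.trace (ZMod (ringChar F)) F x) := by
  rw [charE, ZMod.stdAddChar_apply, ZMod.toCircle_apply]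
  congr 1
  ring

variable [Finite F]

variable (F) in
theorem neZero_ringChar : NeZero (ringChar F) :=
  ⟨(CharP.char_is_prime F _).ne_zero⟩

theorem charE_zero : charE (0 : F) = 1 := by
  have := neZero_ringChar F
  rw [charE_eq_stdAddChar, map_zero, AddChar.map_zero_eq_one]

theorem charE_add (x y : F) : charE (x + y) = charE x * charE y := by
  have := neZero_ringChar F
  rw [charE_eq_stdAddChar, charE_eq_stdAddChar, charE_eq_stdAddChar, map_add,
    AddChar.map_add_eq_mul]

theorem eq_zero_of_charE_mul_eq_one {x : F} (hx : ∀ c : F, charE (c * x) = 1) : x = 0 := by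
  have := neZero_ringChar F
  let _ : Algebra (ZMod (ringChar F)) F := ZMod.algebra F (ringChar F)
  by_contra h0
  obtain ⟨c, hc⟩ := FiniteField.trace_to_zmod_nondegenerate F h0
  apply hc
  have hcx := hx c
  rw [mul_comm, charE_eq_stdAddChar, ← (ZMod.stdAddChar (N := ringChar F)).map_zero_eq_one] at hcx
  exact ZMod.injective_stdAddChar hcx

theorem charInf_zero : charInf (0 : LaurentSeries F) = 1 := by
  rw [charInf, HahnSeries.coeff_zero, charE_zero]

theorem charInf_add (x y : LaurentSeries F) : charInf (x + y) = charInf x * charInf y := by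
  rw [charInf, HahnSeries.coeff_add, charE_add, charInf, charInf]

theorem exists_absInf_sub_le_of_charInf_mul_eq_one {x : LaurentSeries F} {m : ℕ}
    (hx : ∀ p ∈ degreeLT F m, charInf (polyToKInf F p * x) = 1) :
    ∃ p : F[X], absInf (x - polyToKInf F p) ≤ (Nat.card F : ℝ) ^ (-(m : ℤ) - 1) := by
  obtain ⟨p, hp⟩ := exists_coeff_sub_polyToKInf_eq_zero x
  refine ⟨p, absInf_le_zpow_of_le_order fun h0 => ?_⟩
  rw [HahnSeries.le_order_iff_forall h0]
  intro i hi
  rcases le_or_gt i 0 with hi0 | hi0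
  · exact hp i hi0
  obtain ⟨n, rfl⟩ : ∃ n : ℕ, i = n + 1 := ⟨(i - 1).toNat, by lia⟩
  rw [HahnSeries.coeff_sub, polyToKInf_coeff_of_pos p hi0, sub_zero]
  refine eq_zero_of_charE_mul_eq_one fun c => ?_
  have hc := hx (monomial n c) (mem_degreeLT.mpr ((degree_monomial_le n c).trans_lt
    (by norm_cast; lia)))
  rwa [charInf, polyToKInf_monomial, HahnSeries.coeff_single_mul, sub_neg_eq_add,
    add_comm (1 : ℤ)] at hc

end Character

section QuadraticExtension

theorem leftMulMatrix_quadraticAlgebra_basis {R : Type*} [CommRing R] {a b : R}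
    (z : QuadraticAlgebra R a b) :
    Algebra.leftMulMatrix (QuadraticAlgebra.basis a b) z =
      !![z.re, a * z.im; z.im, z.re + b * z.im] := by
  have basis_apply (i : Fin 2) :
      QuadraticAlgebra.basis a b i = ⟨![(1 : R), 0] i, ![(0 : R), 1] i⟩ := by
    apply (QuadraticAlgebra.basis a b).repr.injective
    ext j
    rw [Module.Basis.repr_self, QuadraticAlgebra.basis_repr_apply]
    fin_cases i <;> fin_cases j <;> simp
  ext i j
  rw [Algebra.leftMulMatrix_eq_repr_mul, QuadraticAlgebra.basis_repr_apply, basis_apply]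
  fin_cases i <;> fin_cases j <;> simp

theorem algebra_trace_quadraticAlgebra {R : Type*} [CommRing R] {a b : R}
    (z : QuadraticAlgebra R a b) : Algebra.trace R (QuadraticAlgebra R a b) z = z.trace := by
  rw [Algebra.trace_eq_matrix_trace (QuadraticAlgebra.basis a b),
    leftMulMatrix_quadraticAlgebra_basis, Matrix.trace_fin_two_of, QuadraticAlgebra.trace_def]
  ring

theorem algebra_norm_quadraticAlgebra {R : Type*} [CommRing R] {a b : R}
    (z : QuadraticAlgebra R a b) : Algebra.norm R z = z.norm := by
  rw [Algebra.norm_eq_matrix_det (QuadraticAlgebra.basis a b),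
    leftMulMatrix_quadraticAlgebra_basis, Matrix.det_fin_two_of, QuadraticAlgebra.norm_def]
  ring

variable {k K : Type*} [Field k] [Field K] [Algebra k K] {a : k} {s : K}

theorem exists_quadraticAlgebra_algEquiv (hs : s ^ 2 = algebraMap k K a) (ha : ¬ IsSquare a)
    (htop : IntermediateField.adjoin k {s} = ⊤) :
    ∃ e : QuadraticAlgebra k a 0 ≃ₐ[k] K,
      ∀ x y : k, e ⟨x, y⟩ = algebraMap k K x + algebraMap k K y * s := by
  have : Fact (∀ r : k, r ^ 2 ≠ a + 0 * r) :=
    ⟨fun r hr => ha ⟨r, by rw [← pow_two, hr, zero_mul, add_zero]⟩⟩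
  let f : QuadraticAlgebra k a 0 →ₐ[k] K :=
    QuadraticAlgebra.lift ⟨s, by rw [← pow_two, hs, zero_smul, add_zero, Algebra.smul_def, mul_one]⟩
  have hf (x y : k) : f ⟨x, y⟩ = algebraMap k K x + algebraMap k K y * s := by
    simp [f, Algebra.smul_def]
  have range_eq_top : f.fieldRange = ⊤ := by
    rw [eq_top_iff, ← htop, IntermediateField.adjoin_le_iff, Set.singleton_subset_iff]
    exact ⟨⟨0, 1⟩, by simpa using hf 0 1⟩
  exact ⟨AlgEquiv.ofBijective f ⟨f.injective, AlgHom.fieldRange_eq_top.mp range_eq_top⟩, hf⟩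

theorem exists_eq_add_mul_sqrt (hs : s ^ 2 = algebraMap k K a) (ha : ¬ IsSquare a)
    (htop : IntermediateField.adjoin k {s} = ⊤) (z : K) :
    ∃ x y : k, z = algebraMap k K x + algebraMap k K y * s := by
  obtain ⟨e, he⟩ := exists_quadraticAlgebra_algEquiv hs ha htop
  obtain ⟨⟨x, y⟩, rfl⟩ := e.surjective z
  exact ⟨x, y, he x y⟩

theorem finiteDimensional_of_adjoin_sqrt (hs : s ^ 2 = algebraMap k K a) (ha : ¬ IsSquare a)
    (htop : IntermediateField.adjoin k {s} = ⊤) : FiniteDimensional k K := by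
  obtain ⟨e, -⟩ := exists_quadraticAlgebra_algEquiv hs ha htop
  exact Module.Finite.equiv e.toLinearEquiv

theorem isSeparable_of_adjoin_sqrt (hs : s ^ 2 = algebraMap k K a) (h2 : (2 : k) ≠ 0) (ha : a ≠ 0)
    (htop : IntermediateField.adjoin k {s} = ⊤) : Algebra.IsSeparable k K := by
  have hsep : IsSeparable k s :=
    (separable_X_pow_sub_C (n := 2) a (mod_cast h2) ha).of_dvd
      (minpoly.dvd _ _ (by rw [map_sub, map_pow, aeval_X, aeval_C, hs, sub_self]))
  have := (IntermediateField.isSeparable_adjoin_simple_iff_isSeparable k K).mpr hsep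
  rw [htop] at this
  exact AlgEquiv.Algebra.isSeparable IntermediateField.topEquiv

theorem trace_add_mul_sqrt (hs : s ^ 2 = algebraMap k K a) (ha : ¬ IsSquare a)
    (htop : IntermediateField.adjoin k {s} = ⊤) (x y : k) :
    Algebra.trace k K (algebraMap k K x + algebraMap k K y * s) = 2 * x := by
  obtain ⟨e, he⟩ := exists_quadraticAlgebra_algEquiv hs ha htop
  rw [← he, Algebra.trace_eq_of_algEquiv, algebra_trace_quadraticAlgebra,
    QuadraticAlgebra.trace_def, zero_mul, add_zero]

theorem norm_add_mul_sqrt (hs : s ^ 2 = algebraMap k K a) (ha : ¬ IsSquare a)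
    (htop : IntermediateField.adjoin k {s} = ⊤) (x y : k) :
    Algebra.norm k (algebraMap k K x + algebraMap k K y * s) = x ^ 2 - a * y ^ 2 := by
  obtain ⟨e, he⟩ := exists_quadraticAlgebra_algEquiv hs ha htop
  rw [← he, Algebra.norm_eq_of_algEquiv, algebra_norm_quadraticAlgebra, QuadraticAlgebra.norm_def]
  ring

theorem trace_add_mul_sqrt_div_two_mul_sqrt (hs : s ^ 2 = algebraMap k K a) (ha : ¬ IsSquare a)
    (htop : IntermediateField.adjoin k {s} = ⊤) (h2 : (2 : k) ≠ 0) (x y : k) :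
    Algebra.trace k K ((algebraMap k K x + algebraMap k K y * s) / (2 * s)) = y := by
  have ha0 : a ≠ 0 := by
    rintro rfl
    exact ha IsSquare.zero
  have hs0 : s ≠ 0 := by
    rintro rfl
    exact ha0 ((algebraMap k K).injective (by rw [← hs, map_zero, zero_pow two_ne_zero]))
  have ha0' : algebraMap k K a ≠ 0 := (_root_.map_ne_zero _).mpr ha0
  have h2' : (2 : K) ≠ 0 := map_ofNat (algebraMap k K) 2 ▸ (_root_.map_ne_zero _).mpr h2
  have hdiv : (algebraMap k K x + algebraMap k K y * s) / (2 * s) =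
      algebraMap k K (y / 2) + algebraMap k K (x / (2 * a)) * s := by
    rw [map_div₀, map_div₀, map_mul, map_ofNat]
    field_simp
    rw [← hs]
    ring
  rw [hdiv, trace_add_mul_sqrt hs ha htop, mul_div_cancel₀ y h2]

section Integral

variable {R : Type*} [CommRing R] [IsDomain R] [IsIntegrallyClosed R] [DecompositionMonoid R]
  [Algebra R k] [IsFractionRing R k]

theorem exists_algebraMap_eq_of_squarefree_mul_sq {α w : R} (hα : Squarefree α) {y : k}
    (hy : algebraMap R k α * y ^ 2 = algebraMap R k w) : ∃ r : R, algebraMap R k r = y := by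
  have hα0 : algebraMap R k α ≠ 0 :=
    (map_ne_zero_iff _ (IsFractionRing.injective R k)).mpr hα.ne_zero
  have hsq : (algebraMap R k α * y) ^ 2 = algebraMap R k (α * w) := by
    rw [map_mul, ← hy]
    ring
  obtain ⟨c, hc⟩ := IsIntegrallyClosed.exists_algebraMap_eq_of_isIntegral_pow (R := R) two_pos
    (hsq ▸ isIntegral_algebraMap)
  rw [← hc, ← map_pow] at hsq
  obtain ⟨r, rfl⟩ := (hα.dvd_pow_iff_dvd two_ne_zero).mp
    (Dvd.intro w (IsFractionRing.injective R k hsq).symm)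
  exact ⟨r, mul_left_cancel₀ hα0 (by rw [← hc, map_mul])⟩

variable [Algebra R K] [IsScalarTower R k K]

theorem exists_eq_add_mul_sqrt_of_isIntegral {α : R}
    (hs : s ^ 2 = algebraMap k K (algebraMap R k α)) (ha : ¬ IsSquare (algebraMap R k α))
    (htop : IntermediateField.adjoin k {s} = ⊤) (h2 : IsUnit (2 : R)) (hα : Squarefree α)
    {z : K} (hz : IsIntegral R z) :
    ∃ p r : R, z = algebraMap k K (algebraMap R k p) + algebraMap k K (algebraMap R k r) * s := by
  have := finiteDimensional_of_adjoin_sqrt hs ha htop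
  obtain ⟨x, y, rfl⟩ := exists_eq_add_mul_sqrt hs ha htop z
  obtain ⟨t, ht⟩ := IsIntegrallyClosed.isIntegral_iff.mp (Algebra.isIntegral_trace (L := k) hz)
  obtain ⟨n, hn⟩ := IsIntegrallyClosed.isIntegral_iff.mp (Algebra.isIntegral_norm k hz)
  rw [trace_add_mul_sqrt hs ha htop] at ht
  rw [norm_add_mul_sqrt hs ha htop] at hn
  obtain ⟨p, rfl⟩ := h2.dvd (a := t)
  have h2k : (2 : k) ≠ 0 := map_ofNat (algebraMap R k) 2 ▸ (h2.map (algebraMap R k)).ne_zero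
  obtain rfl : algebraMap R k p = x := mul_left_cancel₀ h2k (by rw [← ht, map_mul, map_ofNat])
  obtain ⟨r, rfl⟩ := exists_algebraMap_eq_of_squarefree_mul_sq (w := p ^ 2 - n) hα (y := y) (by
    rw [map_sub, map_pow, hn]
    ring)
  exact ⟨p, r, rfl⟩

end Integral

end QuadraticExtension

section Divisors

theorem succ_sq_le_four_mul_two_pow (e : ℕ) : (e + 1) ^ 2 ≤ 4 * 2 ^ e := by
  rcases Nat.lt_or_ge e 3 with he | he
  · interval_cases e <;> norm_num
  · induction e, he using Nat.le_induction with
    | base => norm_num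
    | succ n hn ih => rw [pow_succ 2]; nlinarith

theorem succ_sq_le_two_pow_mul {e w : ℕ} (hw : 2 ≤ w) : (e + 1) ^ 2 ≤ 2 ^ (e * w) :=
  calc (e + 1) ^ 2 ≤ (2 ^ e) ^ 2 := Nat.pow_le_pow_left (Nat.succ_le_of_lt Nat.lt_two_pow_self) 2
    _ = 2 ^ (e * 2) := (pow_mul 2 e 2).symm
    _ ≤ 2 ^ (e * w) := Nat.pow_le_pow_right two_pos (Nat.mul_le_mul_left e hw)

theorem card_Iic_sq_le {β : Type*} [DecidableEq β] (S : Multiset β) (w : β → ℕ)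
    (hw : ∀ b ∈ S, 0 < w b) :
    (Finset.Iic S).card ^ 2 ≤ 4 ^ {b ∈ S.toFinset | w b = 1}.card * 2 ^ (S.map w).sum := by
  have map_sum : (S.map w).sum = ∑ b ∈ S.toFinset, S.count b * w b := by
    simp only [Finset.sum_multiset_map_count, smul_eq_mul]
  rw [Multiset.card_Iic, ← Finset.prod_pow, map_sum, ← Finset.prod_pow_eq_pow_sum]
  calc ∏ b ∈ S.toFinset, (S.count b + 1) ^ 2
      ≤ ∏ b ∈ S.toFinset, (if w b = 1 then 4 else 1) * 2 ^ (S.count b * w b) := by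
        refine Finset.prod_le_prod' fun b hb => ?_
        have hwb := hw b (Multiset.mem_toFinset.mp hb)
        split_ifs with hw1
        · rw [hw1, mul_one]; exact succ_sq_le_four_mul_two_pow _
        · rw [one_mul]; exact succ_sq_le_two_pow_mul (by lia)
    _ = 4 ^ {b ∈ S.toFinset | w b = 1}.card * ∏ b ∈ S.toFinset, 2 ^ (S.count b * w b) := by
        rw [Finset.prod_mul_distrib, Finset.prod_ite, Finset.prod_const, Finset.prod_const_one,
          mul_one]

open UniqueFactorizationMonoid in
theorem ncard_dvd_le_card_Iic_normalizedFactors {M : Type*} [CommMonoidWithZero M]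
    [UniqueFactorizationMonoid M] [Subsingleton Mˣ] [DecidableEq M] [NormalizationMonoid M]
    {x : M} (hx : x ≠ 0) : {y | y ∣ x}.ncard ≤ (Finset.Iic (normalizedFactors x)).card := by
  have ne_zero {y : M} (hy : y ∣ x) : y ≠ 0 := ne_zero_of_dvd_ne_zero hx hy
  rw [← Set.ncard_coe_finset]
  refine Set.ncard_le_ncard_of_injOn normalizedFactors (fun y hy => ?_) (fun y hy z hz hyz => ?_)
  · rw [Finset.mem_coe, Finset.mem_Iic,
      ← dvd_iff_normalizedFactors_le_normalizedFactors (ne_zero hy) hx]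
    exact hy
  · exact associated_iff_eq.mp
      ((associated_iff_normalizedFactors_eq_normalizedFactors (ne_zero hy) (ne_zero hz)).mpr hyz)

end Divisors

section DedekindDivisors

variable {R : Type*} [CommRing R] [IsDedekindDomain R]

theorem finite_setOf_ideal_dvd {I : Ideal R} (hI : I ≠ ⊥) : {J | J ∣ I}.Finite :=
  Set.finite_coe_iff.mp (UniqueFactorizationMonoid.fintypeSubtypeDvd I hI).finite

theorem setOf_span_singleton_eq_subset_range (u : R) :
    {x | Ideal.span {x} = Ideal.span {u}} ⊆ Set.range fun w : Rˣ => u * w := fun x hx => by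
  obtain ⟨w, rfl⟩ := Ideal.span_singleton_eq_span_singleton.mp (Eq.symm hx)
  exact ⟨w, rfl⟩

variable [Finite Rˣ]

theorem finite_setOf_span_singleton_eq (I : Ideal R) : {x | Ideal.span {x} = I}.Finite := by
  rcases {x | Ideal.span {x} = I}.eq_empty_or_nonempty with h | ⟨u, rfl⟩
  · exact h ▸ Set.finite_empty
  · exact (Set.finite_range _).subset (setOf_span_singleton_eq_subset_range u)

theorem ncard_setOf_span_singleton_eq_le (I : Ideal R) :
    {x | Ideal.span {x} = I}.ncard ≤ Nat.card Rˣ := by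
  rcases {x | Ideal.span {x} = I}.eq_empty_or_nonempty with h | ⟨u, rfl⟩
  · simp only [h, Set.ncard_empty, zero_le]
  · calc _ ≤ _ := Set.ncard_le_ncard (setOf_span_singleton_eq_subset_range u) (Set.finite_range _)
      _ ≤ Nat.card Rˣ := by
        rw [← Set.image_univ, ← Set.ncard_univ]
        exact Set.ncard_image_le

theorem finite_setOf_dvd {m : R} (hm : m ≠ 0) : {u | u ∣ m}.Finite := by
  have preimage : {u | u ∣ m} = (fun u => Ideal.span {u}) ⁻¹' {J | J ∣ Ideal.span {m}} := by
    ext u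
    exact (Ideal.dvd_span_singleton.trans Ideal.mem_span_singleton).symm
  rw [preimage]
  exact (finite_setOf_ideal_dvd (by rwa [Ne, Ideal.span_singleton_eq_bot])).preimage'
    fun J _ => finite_setOf_span_singleton_eq J

theorem ncard_dvd_le_mul_ncard_ideal_dvd {m : R} (hm : m ≠ 0) :
    {u | u ∣ m}.ncard ≤ Nat.card Rˣ * {J | J ∣ Ideal.span {m}}.ncard := by
  refine ncard_le_mul_ncard_of_mapsTo (fun u => Ideal.span {u}) (finite_setOf_dvd hm)
    (finite_setOf_ideal_dvd (by rwa [Ne, Ideal.span_singleton_eq_bot])) (fun u hu => ?_) _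
    fun J _ => ?_
  · exact Ideal.dvd_span_singleton.mpr (Ideal.mem_span_singleton.mpr hu)
  · exact (Set.ncard_le_ncard (fun u hu => hu.2) (finite_setOf_span_singleton_eq J)).trans
      (ncard_setOf_span_singleton_eq_le J)

end DedekindDivisors

section SquareDifferencing

variable {R : Type*} [CommRing R]

theorem mapsTo_sub_setOf_sq_sub_sq_eq (m : R) :
    Set.MapsTo (fun p : R × R => p.1 - p.2) {p | p.1 ^ 2 - p.2 ^ 2 = m} {u | u ∣ m} :=
  fun p hp => ⟨p.1 + p.2, by rw [← hp]; ring⟩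

variable [IsDomain R]

theorem ncard_sq_eq_sq_le {S : Set R} (hS : S.Finite) :
    {p ∈ S ×ˢ S | p.1 ^ 2 = p.2 ^ 2}.ncard ≤ 2 * S.ncard := by
  refine ncard_le_mul_ncard_of_mapsTo Prod.snd ((hS.prod hS).subset fun p hp => hp.1) hS
    (fun p hp => hp.1.2) 2 fun b _ => ?_
  have fiber : {p ∈ {p ∈ S ×ˢ S | p.1 ^ 2 = p.2 ^ 2} | p.2 = b} ⊆ {(b, b), (-b, b)} := by
    rintro ⟨a, _⟩ ⟨⟨-, hab⟩, rfl⟩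
    rcases sq_eq_sq_iff_eq_or_eq_neg.mp hab with h | h
    · exact Or.inl (Prod.ext h rfl)
    · exact Or.inr (Prod.ext h rfl)
  exact (Set.ncard_le_ncard fiber (Set.toFinite _)).trans (by
    simpa only [Set.ncard_singleton] using Set.ncard_insert_le (b, b) {(-b, b)})

theorem injOn_sub_setOf_sq_sub_sq_eq (h2 : (2 : R) ≠ 0) {m : R} (hm : m ≠ 0) :
    Set.InjOn (fun p : R × R => p.1 - p.2) {p | p.1 ^ 2 - p.2 ^ 2 = m} := by
  rintro ⟨a, b⟩ hab ⟨c, d⟩ hcd (hsub : a - b = c - d)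
  replace hab : (a - b) * (a + b) = m := by rw [← hab]; ring
  replace hcd : (a - b) * (c + d) = m := by rw [hsub, ← hcd]; ring
  have hadd : a + b = c + d :=
    mul_left_cancel₀ (left_ne_zero_of_mul (hab ▸ hm)) (hab.trans hcd.symm)
  have hac : a = c := mul_left_cancel₀ h2 (by linear_combination hsub + hadd)
  exact Prod.ext hac (by linear_combination hadd - hac)

theorem ncard_sq_sub_sq_eq_le_ncard_dvd (h2 : (2 : R) ≠ 0) {m : R} (hm : m ≠ 0)
    (hfin : {u | u ∣ m}.Finite) :
    {p : R × R | p.1 ^ 2 - p.2 ^ 2 = m}.ncard ≤ {u | u ∣ m}.ncard :=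
  Set.ncard_le_ncard_of_injOn _ (mapsTo_sub_setOf_sq_sub_sq_eq m)
    (injOn_sub_setOf_sq_sub_sq_eq h2 hm) hfin

theorem finite_setOf_sq_sub_sq_eq (h2 : (2 : R) ≠ 0) {m : R} (hm : m ≠ 0)
    (hfin : {u | u ∣ m}.Finite) : {p : R × R | p.1 ^ 2 - p.2 ^ 2 = m}.Finite :=
  hfin.of_injOn (mapsTo_sub_setOf_sq_sub_sq_eq m) (injOn_sub_setOf_sq_sub_sq_eq h2 hm)

theorem ncard_sq_le_of_sq_sub_sq_mem (h2 : (2 : R) ≠ 0) {S T : Set R} (hS : S.Finite)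
    (hT : T.Finite) (hST : ∀ a ∈ S, ∀ b ∈ S, a ^ 2 - b ^ 2 ∈ T) {D : ℕ}
    (hfin : ∀ m ∈ T, m ≠ 0 → {u | u ∣ m}.Finite)
    (hD : ∀ m ∈ T, m ≠ 0 → {u | u ∣ m}.ncard ≤ D) :
    S.ncard ^ 2 ≤ 2 * S.ncard + D * T.ncard := by
  have hprod := hS.prod hS
  have off_diagonal : {p ∈ S ×ˢ S | p.1 ^ 2 ≠ p.2 ^ 2}.ncard ≤ D * T.ncard := by
    refine (ncard_le_mul_ncard_of_mapsTo (t := T \ {0}) (fun p => p.1 ^ 2 - p.2 ^ 2)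
      (hprod.subset fun p hp => hp.1) (hT.subset Set.sdiff_subset)
      (fun p hp => ⟨hST _ hp.1.1 _ hp.1.2, sub_ne_zero.mpr hp.2⟩) D fun m hm => ?_).trans
      (Nat.mul_le_mul_left D (Set.ncard_le_ncard Set.sdiff_subset hT))
    calc _ ≤ {p : R × R | p.1 ^ 2 - p.2 ^ 2 = m}.ncard :=
          Set.ncard_le_ncard (fun p hp => hp.2)
            (finite_setOf_sq_sub_sq_eq h2 hm.2 (hfin m hm.1 hm.2))
      _ ≤ {u | u ∣ m}.ncard := ncard_sq_sub_sq_eq_le_ncard_dvd h2 hm.2 (hfin m hm.1 hm.2)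
      _ ≤ D := hD m hm.1 hm.2
  have cover : S ×ˢ S ⊆ {p ∈ S ×ˢ S | p.1 ^ 2 = p.2 ^ 2} ∪ {p ∈ S ×ˢ S | p.1 ^ 2 ≠ p.2 ^ 2} :=
    fun p hp => (eq_or_ne (p.1 ^ 2) (p.2 ^ 2)).imp (⟨hp, ·⟩) (⟨hp, ·⟩)
  calc S.ncard ^ 2 = (S ×ˢ S).ncard := by rw [Set.ncard_prod, sq]
    _ ≤ _ := Set.ncard_le_ncard cover
      ((hprod.subset fun p hp => hp.1).union (hprod.subset fun p hp => hp.1))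
    _ ≤ _ := Set.ncard_union_le _ _
    _ ≤ _ := add_le_add (ncard_sq_eq_sq_le hS) off_diagonal

end SquareDifferencing

section NormDegree

open UniqueFactorizationMonoid

theorem hasFiniteQuotients_polynomial (F : Type*) [Field F] [Finite F] :
    Ring.HasFiniteQuotients F[X] where
  finiteQuotient {I} hI := by
    obtain ⟨p, rfl⟩ := IsPrincipalIdealRing.principal I
    have hp : p ≠ 0 := by rintro rfl; simp at hI
    have := (monic_mul_leadingCoeff_inv hp).finite_quotient
    rw [Ideal.submodule_span_eq, ← Ideal.span_singleton_mul_right_unit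
      (isUnit_C.mpr (inv_ne_zero (leadingCoeff_ne_zero.mpr hp)).isUnit)]
    exact Module.finite_of_finite F

variable (F : Type*) {R : Type*} [Field F] [CommRing R] [IsDedekindDomain R] [Algebra F[X] R]
  [Module.Finite F[X] R] [Module.IsTorsionFree F[X] R]

/-- The degree of the relative norm of an ideal `I` to the principal ideal domain `F[X]`. Over a
field `F` with `q` elements, `q ^ normDegree F I` plays the role of the absolute norm of `I`. -/
def normDegree (I : Ideal R) : ℕ :=
  (Submodule.IsPrincipal.generator (Ideal.relNorm F[X] I)).natDegree

variable {F}

theorem normDegree_eq_natDegree {I : Ideal R} {p : F[X]}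
    (hp : Ideal.relNorm F[X] I = Ideal.span {p}) : normDegree F I = p.natDegree :=
  natDegree_eq_of_degree_eq (degree_eq_degree_of_associated
    (Ideal.span_singleton_eq_span_singleton.mp ((Ideal.span_singleton_generator _).trans hp)))

variable (F)

theorem exists_relNorm_eq_span_singleton {I : Ideal R} (hI : I ≠ ⊥) :
    ∃ p : F[X], p ≠ 0 ∧ Ideal.relNorm F[X] I = Ideal.span {p} := by
  refine ⟨_, ?_, (Ideal.span_singleton_generator (Ideal.relNorm F[X] I)).symm⟩
  rwa [Ne, ← Submodule.IsPrincipal.eq_bot_iff_generator_eq_zero, Ideal.relNorm_eq_bot_iff]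

theorem normDegree_one : normDegree F (1 : Ideal R) = 0 := by
  rw [normDegree_eq_natDegree (p := 1), natDegree_one]
  rw [map_one, Ideal.span_singleton_one, Ideal.one_eq_top]

theorem normDegree_mul {I J : Ideal R} (hI : I ≠ ⊥) (hJ : J ≠ ⊥) :
    normDegree F (I * J) = normDegree F I + normDegree F J := by
  obtain ⟨p, hp, hpI⟩ := exists_relNorm_eq_span_singleton F hI
  obtain ⟨r, hr, hrJ⟩ := exists_relNorm_eq_span_singleton F hJ
  rw [normDegree_eq_natDegree hpI, normDegree_eq_natDegree hrJ, ← natDegree_mul hp hr]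
  apply normDegree_eq_natDegree
  rw [map_mul, hpI, hrJ, Ideal.span_singleton_mul_span_singleton]

theorem normDegree_multiset_prod {S : Multiset (Ideal R)} (hS : (0 : Ideal R) ∉ S) :
    normDegree F S.prod = (S.map (normDegree F)).sum := by
  induction S using Multiset.induction_on with
  | empty => rw [Multiset.prod_zero, normDegree_one, Multiset.map_zero, Multiset.sum_zero]
  | cons I S ih =>
    rw [Multiset.mem_cons, not_or] at hS
    rw [Multiset.prod_cons, Multiset.map_cons, Multiset.sum_cons,
      normDegree_mul F (Ne.symm hS.1) (Multiset.prod_ne_zero hS.2), ih hS.2]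

theorem normDegree_eq_sum_normalizedFactors {I : Ideal R} (hI : I ≠ ⊥) :
    normDegree F I = ((normalizedFactors I).map (normDegree F)).sum := by
  rw [← normDegree_multiset_prod F (zero_notMem_normalizedFactors I),
    Ideal.prod_normalizedFactors_eq_self hI]

theorem normDegree_pos {I : Ideal R} (hI : I ≠ ⊤) (h0 : I ≠ ⊥) : 0 < normDegree F I := by
  obtain ⟨p, hp, hpI⟩ := exists_relNorm_eq_span_singleton F h0
  have hle := Ideal.relNorm_le_comap F[X] I
  rw [normDegree_eq_natDegree hpI]
  by_contra! hdeg
  have hunit : IsUnit p := by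
    rw [isUnit_iff_degree_eq_zero, degree_eq_natDegree hp, Nat.le_zero.mp hdeg, Nat.cast_zero]
  rw [hpI, Ideal.span_singleton_eq_top.mpr hunit, top_le_iff, Ideal.comap_eq_top_iff] at hle
  exact hI hle

theorem normDegree_pos_of_mem_normalizedFactors {I P : Ideal R} (hP : P ∈ normalizedFactors I) :
    0 < normDegree F P := by
  have prime := prime_of_normalized_factor P hP
  exact normDegree_pos F (Ideal.one_eq_top (R := R) ▸ prime.ne_one) prime.ne_zero

theorem card_normalizedFactors_le_normDegree {I : Ideal R} (hI : I ≠ ⊥) :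
    (normalizedFactors I).card ≤ normDegree F I := by
  have one_le : ∀ n ∈ (normalizedFactors I).map (normDegree F), 1 ≤ n := by
    intro n hn
    obtain ⟨P, hP, rfl⟩ := Multiset.mem_map.mp hn
    exact normDegree_pos_of_mem_normalizedFactors F hP
  rw [normDegree_eq_sum_normalizedFactors F hI]
  simpa using Multiset.card_nsmul_le_sum one_le

variable {F}

theorem exists_eq_C_mul_X_sub_C {p : F[X]} (hp : p.natDegree = 1) :
    ∃ a c : F, a ≠ 0 ∧ p = C a * (X - C c) := by
  have ha : p.coeff 1 ≠ 0 := by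
    rw [← hp, coeff_natDegree, leadingCoeff_ne_zero]
    rintro rfl
    simp at hp
  refine ⟨p.coeff 1, -(p.coeff 0 / p.coeff 1), ha, ?_⟩
  conv_lhs => rw [eq_X_add_C_of_natDegree_le_one hp.le]
  rw [mul_sub, ← C_mul, mul_neg, mul_div_cancel₀ _ ha, C_neg, sub_neg_eq_add]

theorem exists_X_sub_C_mem_of_normDegree_eq_one {P : Ideal R} (hP : normDegree F P = 1) :
    ∃ c : F, algebraMap F[X] R (X - C c) ∈ P := by
  obtain ⟨a, c, ha, hac⟩ := exists_eq_C_mul_X_sub_C hP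
  refine ⟨c, (Ideal.unit_mul_mem_iff_mem (P.comap (algebraMap F[X] R))
    (isUnit_C.mpr ha.isUnit)).mp ?_⟩
  rw [← hac]
  exact Ideal.relNorm_le_comap F[X] P (Submodule.IsPrincipal.generator_mem _)

theorem card_le_of_normDegree_eq_one [Finite F] {n : ℕ}
    (hn : ∀ c : F, normDegree F (Ideal.span {algebraMap F[X] R (X - C c)}) ≤ n)
    (S : Finset (Ideal R)) (hS : ∀ P ∈ S, Prime P ∧ normDegree F P = 1) :
    S.card ≤ Nat.card F * n := by
  classical
  have : Fintype F := Fintype.ofFinite F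
  have ne_bot (c : F) : Ideal.span {algebraMap F[X] R (X - C c)} ≠ ⊥ := by
    rw [Ne, Ideal.span_singleton_eq_bot, map_eq_zero_iff _ (FaithfulSMul.algebraMap_injective _ _)]
    exact X_sub_C_ne_zero c
  have cover : S ⊆ Finset.univ.biUnion fun c : F =>
      (normalizedFactors (Ideal.span {algebraMap F[X] R (X - C c)})).toFinset := by
    intro P hP
    obtain ⟨prime, hP1⟩ := hS P hP
    obtain ⟨c, hc⟩ := exists_X_sub_C_mem_of_normDegree_eq_one hP1
    rw [Finset.mem_biUnion]
    refine ⟨c, Finset.mem_univ c, ?_⟩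
    rw [Multiset.mem_toFinset, Ideal.mem_normalizedFactors_iff (ne_bot c)]
    exact ⟨Ideal.isPrime_of_prime prime, (Ideal.span_singleton_le_iff_mem P).mpr hc⟩
  calc S.card ≤ _ := Finset.card_le_card cover
    _ ≤ Finset.univ.card * n := Finset.card_biUnion_le_card_mul _ _ _ fun c _ =>
      (Multiset.toFinset_card_le _).trans
        ((card_normalizedFactors_le_normDegree F (ne_bot c)).trans (hn c))
    _ = _ := by rw [Finset.card_univ, Nat.card_eq_fintype_card]

theorem ncard_ideal_dvd_sq_le [Finite F] {n : ℕ}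
    (hn : ∀ c : F, normDegree F (Ideal.span {algebraMap F[X] R (X - C c)}) ≤ n)
    {I : Ideal R} (hI : I ≠ ⊥) :
    {J | J ∣ I}.ncard ^ 2 ≤ 4 ^ (Nat.card F * n) * 2 ^ normDegree F I := by
  classical
  calc {J | J ∣ I}.ncard ^ 2 ≤ (Finset.Iic (normalizedFactors I)).card ^ 2 :=
        Nat.pow_le_pow_left (ncard_dvd_le_card_Iic_normalizedFactors hI) 2
    _ ≤ _ := card_Iic_sq_le _ _ fun P hP => normDegree_pos_of_mem_normalizedFactors F hP
    _ ≤ _ := by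
      rw [← normDegree_eq_sum_normalizedFactors F hI]
      gcongr
      · norm_num
      · refine card_le_of_normDegree_eq_one hn _ fun P hP => ?_
        rw [Finset.mem_filter, Multiset.mem_toFinset] at hP
        exact ⟨prime_of_normalized_factor P hP.1, hP.2⟩

end NormDegree

/-- The setting of the theorem: `K = k(√α)` is an imaginary quadratic extension of `k = F(t)` in odd
characteristic, `s` is the chosen square root of `α`, and `v` extends the absolute value at
infinity. -/
structure IsImaginaryQuadratic {F K : Type*} [Field F] [Field K] [Algebra F[X] K]
    [Algebra (RatFunc F) K] (α : F[X]) (s : K) (v : AbsoluteValue K ℝ) : Prop where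
  two_lt_ringChar : 2 < ringChar F
  squarefree : Squarefree α
  odd_or_not_isSquare : Odd α.natDegree ∨ ¬ IsSquare α.leadingCoeff
  sq_eq : s ^ 2 = algebraMap F[X] K α
  adjoin_eq_top : IntermediateField.adjoin (RatFunc F) {s} = ⊤
  abs_algebraMap : ∀ x : RatFunc F, v (algebraMap (RatFunc F) K x) = absInf (toKInf F x)

theorem isTorsionFree_integralClosure (R k K : Type*) [CommRing R] [IsDomain R] [Field k] [Field K]
    [Algebra R k] [IsFractionRing R k] [Algebra k K] [Algebra R K] [IsScalarTower R k K] :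
    Module.IsTorsionFree R (integralClosure R K) := by
  have : FaithfulSMul R K := by
    rw [faithfulSMul_iff_algebraMap_injective, IsScalarTower.algebraMap_eq R k K]
    exact (algebraMap k K).injective.comp (IsFractionRing.injective R k)
  infer_instance

theorem abs_add_le_max_of_natCast_le_one {K : Type*} [Field K] (v : AbsoluteValue K ℝ)
    (hv : ∀ n : ℕ, v n ≤ 1) (x y : K) : v (x + y) ≤ max (v x) (v y) := by
  let _ := v.toNormedField
  have : IsUltrametricDist K :=
    IsUltrametricDist.isUltrametricDist_of_forall_norm_natCast_le_one hv
  exact IsUltrametricDist.norm_add_le_max x y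

theorem pow_mul_absInf_sq_le_iff {F : Type*} [Field F] [Finite F] {p : F[X]} {d N : ℕ} :
    (Nat.card F : ℝ) ^ d * absInf (polyToKInf F p) ^ 2 ≤ (Nat.card F : ℝ) ^ N ↔
      p ∈ degreeLT F ((N + 2 - d) / 2) := by
  by_cases hp : p = 0
  · simp [hp, absInf_zero, zero_mem]
  rw [absInf_polyToKInf hp, ← pow_mul, ← pow_add, pow_le_pow_iff_right₀ (one_lt_card F),
    mem_degreeLT, ← natDegree_lt_iff_degree_lt hp]
  omega

theorem ncard_degreeLT {F : Type*} [Field F] (n : ℕ) :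
    (degreeLT F n : Set F[X]).ncard = Nat.card F ^ n := by
  rw [← Nat.card_coe_set_eq]
  refine (Nat.card_congr (degreeLTEquiv F n).toEquiv).trans ?_
  rw [Nat.card_fun, Nat.card_fin]

theorem finite_degreeLT {F : Type*} [Field F] [Finite F] (n : ℕ) :
    (degreeLT F n : Set F[X]).Finite :=
  Set.finite_coe_iff.mp (Finite.of_equiv _ (degreeLTEquiv F n).toEquiv.symm)

theorem moduli_subset_ballInt {F K : Type*} [Field F] [Field K] [Algebra F[X] K]
    (v : AbsoluteValue K ℝ) (Q : ℕ) : moduli (F := F) v Q ⊆ ballInt v Q :=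
  fun _ hf => hf.2.le

/-- The additive character `z ↦ e(Tr(z / (2 s)))` of `K`, for which `𝔸` is, up to a bounded error,
self-dual. -/
def traceChar (F : Type*) {K : Type*} [Field F] [Finite F] [Field K] [Algebra (RatFunc F) K]
    (s : K) : AddChar K ℂ where
  toFun z := charInf (toKInf F (Algebra.trace (RatFunc F) K (z / (2 * s))))
  map_zero_eq_one' := by rw [zero_div, map_zero, map_zero, charInf_zero]
  map_add_eq_mul' x y := by rw [add_div, map_add, map_add, charInf_add]

namespace IsImaginaryQuadratic

variable {F K : Type*} [Field F] [Field K] [Algebra F[X] K] [Algebra (RatFunc F) K]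
  {α : F[X]} {s : K} {v : AbsoluteValue K ℝ}

local notation "ι" => algebraMap (RatFunc F) K
local notation "κ" => algebraMap (Polynomial F) (RatFunc F)
local notation "𝔸" => integralClosure (Polynomial F) K

theorem two_ne_zero_base (h : IsImaginaryQuadratic α s v) : (2 : F) ≠ 0 :=
  Ring.two_ne_zero h.two_lt_ringChar.ne'

theorem two_ne_zero_ratFunc (h : IsImaginaryQuadratic α s v) : (2 : RatFunc F) ≠ 0 :=
  map_ofNat (algebraMap F (RatFunc F)) 2 ▸ (_root_.map_ne_zero _).mpr h.two_ne_zero_base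

theorem two_ne_zero (h : IsImaginaryQuadratic α s v) : (2 : K) ≠ 0 :=
  map_ofNat (algebraMap (RatFunc F) K) 2 ▸ (_root_.map_ne_zero _).mpr h.two_ne_zero_ratFunc

theorem isUnit_two (h : IsImaginaryQuadratic α s v) : IsUnit (2 : F[X]) :=
  map_ofNat (C : F →+* F[X]) 2 ▸ isUnit_C.mpr h.two_ne_zero_base.isUnit

theorem algebraMap_ne_zero (h : IsImaginaryQuadratic α s v) : κ α ≠ 0 :=
  (map_ne_zero_iff _ (IsFractionRing.injective F[X] (RatFunc F))).mpr h.squarefree.ne_zero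

theorem isIntegral_sqrt (h : IsImaginaryQuadratic α s v) : IsIntegral F[X] s := by
  apply IsIntegral.of_pow two_pos
  rw [h.sq_eq]
  exact isIntegral_algebraMap

/-- The integer `p + r √α` of `K`. -/
def toInt (h : IsImaginaryQuadratic α s v) (p r : F[X]) : 𝔸 :=
  algebraMap F[X] 𝔸 p + algebraMap F[X] 𝔸 r * ⟨s, h.isIntegral_sqrt⟩

theorem abs_natCast_le_one (h : IsImaginaryQuadratic α s v) (n : ℕ) : v n ≤ 1 := by
  rw [← map_natCast ι n, h.abs_algebraMap, ← map_natCast κ, toKInf_algebraMap]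
  by_cases hn : (n : F[X]) = 0
  · rw [hn, map_zero, absInf_zero]
    exact zero_le_one
  · rw [absInf_polyToKInf hn, natDegree_natCast, pow_zero]

theorem abs_sq_add_le (h : IsImaginaryQuadratic α s v) {x y : K} {B : ℝ}
    (hx : v x ^ 2 ≤ B) (hy : v y ^ 2 ≤ B) : v (x + y) ^ 2 ≤ B := by
  rcases le_max_iff.mp (abs_add_le_max_of_natCast_le_one v h.abs_natCast_le_one x y) with hxy | hxy
  · exact (pow_le_pow_left₀ (v.nonneg _) hxy 2).trans hx
  · exact (pow_le_pow_left₀ (v.nonneg _) hxy 2).trans hy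

theorem abs_sq_sub_le (h : IsImaginaryQuadratic α s v) {x y : K} {B : ℝ}
    (hx : v x ^ 2 ≤ B) (hy : v y ^ 2 ≤ B) : v (x - y) ^ 2 ≤ B := by
  rw [sub_eq_add_neg]
  exact h.abs_sq_add_le hx (by rwa [v.map_neg])

theorem not_isSquare [Finite F] (h : IsImaginaryQuadratic α s v) : ¬ IsSquare (κ α) := by
  intro hsq
  obtain ⟨c, hc⟩ := isSquare_iff_exists_sq _ |>.mp hsq
  have norm_form := absInf_sq_sub_mul_sq h.odd_or_not_isSquare (toKInf F c) 1
  rw [← map_pow, ← hc, toKInf_algebraMap, one_pow, mul_one, sub_self, absInf_zero,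
    ← absInf_sq, ← absInf_sq, ← absInf_mul, one_pow, mul_one] at norm_form
  have hα : absInf (polyToKInf F α) = 0 :=
    le_antisymm (norm_form ▸ le_max_right _ _) (absInf_nonneg _)
  rw [absInf_eq_zero, map_eq_zero_iff _ (polyToKInf_injective F)] at hα
  exact h.squarefree.ne_zero hα

theorem absInf_toKInf_sq_sub_mul_sq [Finite F] (h : IsImaginaryQuadratic α s v) (x y : RatFunc F) :
    absInf (toKInf F (x ^ 2 - κ α * y ^ 2)) = max (absInf (toKInf F x) ^ 2)
      ((Nat.card F : ℝ) ^ α.natDegree * absInf (toKInf F y) ^ 2) := by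
  rw [← absInf_polyToKInf h.squarefree.ne_zero,
    ← absInf_sq_sub_mul_sq h.odd_or_not_isSquare, map_sub, map_mul, map_pow, map_pow,
    toKInf_algebraMap]

variable [IsScalarTower F[X] (RatFunc F) K]

theorem sq_eq_algebraMap (h : IsImaginaryQuadratic α s v) : s ^ 2 = ι (κ α) := by
  rw [h.sq_eq, IsScalarTower.algebraMap_apply F[X] (RatFunc F) K]

theorem coe_toInt (h : IsImaginaryQuadratic α s v) (p r : F[X]) :
    (h.toInt p r : K) = ι (κ p) + ι (κ r) * s := by
  rw [← IsScalarTower.algebraMap_apply, ← IsScalarTower.algebraMap_apply]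
  rfl

theorem isSeparable (h : IsImaginaryQuadratic α s v) : Algebra.IsSeparable (RatFunc F) K :=
  isSeparable_of_adjoin_sqrt h.sq_eq_algebraMap h.two_ne_zero_ratFunc h.algebraMap_ne_zero
    h.adjoin_eq_top

theorem abs_sq_sqrt (h : IsImaginaryQuadratic α s v) :
    v s ^ 2 = (Nat.card F : ℝ) ^ α.natDegree := by
  rw [← map_pow, h.sq_eq_algebraMap, h.abs_algebraMap, toKInf_algebraMap,
    absInf_polyToKInf h.squarefree.ne_zero]

variable [Finite F]

theorem finiteDimensional (h : IsImaginaryQuadratic α s v) : FiniteDimensional (RatFunc F) K :=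
  finiteDimensional_of_adjoin_sqrt h.sq_eq_algebraMap h.not_isSquare h.adjoin_eq_top

theorem exists_eq_add_mul (h : IsImaginaryQuadratic α s v) (z : K) :
    ∃ x y : RatFunc F, z = ι x + ι y * s :=
  exists_eq_add_mul_sqrt h.sq_eq_algebraMap h.not_isSquare h.adjoin_eq_top z

theorem abs_sq_add_mul (h : IsImaginaryQuadratic α s v) (x y : RatFunc F) :
    v (ι x + ι y * s) ^ 2 = max (absInf (toKInf F x) ^ 2)
      ((Nat.card F : ℝ) ^ α.natDegree * absInf (toKInf F y) ^ 2) := by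
  set M := max (absInf (toKInf F x) ^ 2)
    ((Nat.card F : ℝ) ^ α.natDegree * absInf (toKInf F y) ^ 2) with hM
  have hx : v (ι x) ^ 2 ≤ M := by
    rw [h.abs_algebraMap]
    exact le_max_left _ _
  have hy : v (ι y * s) ^ 2 ≤ M := by
    rw [map_mul, mul_pow, h.abs_sq_sqrt, h.abs_algebraMap, mul_comm]
    exact le_max_right _ _
  -- Both conjugates have absolute value at most `√M`, and their product is the norm, which has
  -- absolute value `M`.
  have abs_mul_conj : v (ι x + ι y * s) * v (ι x - ι y * s) = M := by
    rw [hM, ← h.absInf_toKInf_sq_sub_mul_sq, ← h.abs_algebraMap, ← map_mul]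
    congr 1
    rw [map_sub, map_mul, map_pow, map_pow, ← h.sq_eq_algebraMap]
    ring
  refine le_antisymm (h.abs_sq_add_le hx hy) ?_
  rcases ((sq_nonneg _).trans hx).eq_or_lt with hM0 | hM0
  · rw [← hM0]
    exact sq_nonneg _
  refine le_of_mul_le_mul_right ?_ hM0
  calc M * M = v (ι x + ι y * s) ^ 2 * v (ι x - ι y * s) ^ 2 := by
        rw [← mul_pow, abs_mul_conj, pow_two]
    _ ≤ v (ι x + ι y * s) ^ 2 * M := by
        gcongr
        exact h.abs_sq_sub_le hx hy

theorem abs_sq_eq_absInf_norm (h : IsImaginaryQuadratic α s v) (z : K) :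
    v z ^ 2 = absInf (toKInf F (Algebra.norm (RatFunc F) z)) := by
  obtain ⟨x, y, rfl⟩ := h.exists_eq_add_mul z
  rw [h.abs_sq_add_mul, norm_add_mul_sqrt h.sq_eq_algebraMap h.not_isSquare h.adjoin_eq_top,
    h.absInf_toKInf_sq_sub_mul_sq]

section Integers

theorem exists_toInt_eq (h : IsImaginaryQuadratic α s v) (x : 𝔸) : ∃ p r, x = h.toInt p r := by
  obtain ⟨p, r, hx⟩ := exists_eq_add_mul_sqrt_of_isIntegral h.sq_eq_algebraMap h.not_isSquare
    h.adjoin_eq_top h.isUnit_two h.squarefree x.2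
  exact ⟨p, r, Subtype.ext (hx.trans (h.coe_toInt p r).symm)⟩

theorem toInt_mem_ballInt_iff (h : IsImaginaryQuadratic α s v) {p r : F[X]} {N : ℕ} :
    h.toInt p r ∈ ballInt v N ↔ p ∈ degreeLT F ((N + 2) / 2) ∧
      r ∈ degreeLT F ((N + 2 - α.natDegree) / 2) := by
  rw [ballInt, Set.mem_ofPred_eq, coe_toInt, h.abs_sq_add_mul, toKInf_algebraMap,
    toKInf_algebraMap, max_le_iff, pow_mul_absInf_sq_le_iff,
    ← one_mul (absInf (polyToKInf F p) ^ 2), ← pow_zero (Nat.card F : ℝ), pow_mul_absInf_sq_le_iff,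
    Nat.sub_zero]

theorem ballInt_eq_image (h : IsImaginaryQuadratic α s v) (N : ℕ) :
    ballInt v N = (fun x : F[X] × F[X] => h.toInt x.1 x.2) ''
      ((degreeLT F ((N + 2) / 2) : Set F[X]) ×ˢ
        (degreeLT F ((N + 2 - α.natDegree) / 2) : Set F[X])) := by
  refine Set.Subset.antisymm (fun g hg => ?_) (Set.image_subset_iff.mpr fun x hx =>
    h.toInt_mem_ballInt_iff.mpr hx)
  obtain ⟨p, r, rfl⟩ := h.exists_toInt_eq g
  exact ⟨(p, r), h.toInt_mem_ballInt_iff.mp hg, rfl⟩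

theorem finite_ballInt (h : IsImaginaryQuadratic α s v) (N : ℕ) :
    (ballInt (F := F) v N).Finite := by
  rw [h.ballInt_eq_image]
  exact ((finite_degreeLT _).prod (finite_degreeLT _)).image _

theorem ncard_ballInt_le (h : IsImaginaryQuadratic α s v) (N : ℕ) :
    (ballInt (F := F) v N).ncard ≤ Nat.card F ^ (N + 2) := by
  rw [h.ballInt_eq_image]
  refine (Set.ncard_image_le ((finite_degreeLT _).prod (finite_degreeLT _))).trans ?_
  rw [Set.ncard_prod, ncard_degreeLT, ncard_degreeLT, ← pow_add]
  exact Nat.pow_le_pow_right Nat.card_pos (by omega)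

theorem finite_moduli (h : IsImaginaryQuadratic α s v) (Q : ℕ) : (moduli (F := F) v Q).Finite :=
  (h.finite_ballInt Q).subset (moduli_subset_ballInt v Q)

end Integers

section Duality

theorem traceChar_toInt_mul (h : IsImaginaryQuadratic α s v) (p r : F[X]) (x y : RatFunc F) :
    traceChar F s (h.toInt p r * (ι x + ι y * s)) =
      charInf (polyToKInf F p * toKInf F y + polyToKInf F r * toKInf F x) := by
  have mul_eq : (h.toInt p r : K) * (ι x + ι y * s) =
      ι (κ p * x + κ r * (κ α * y)) + ι (κ p * y + κ r * x) * s := by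
    simp only [coe_toInt, map_add, map_mul, ← h.sq_eq_algebraMap]
    ring
  have trace_eq := trace_add_mul_sqrt_div_two_mul_sqrt h.sq_eq_algebraMap h.not_isSquare
    h.adjoin_eq_top h.two_ne_zero_ratFunc
  change charInf (toKInf F (Algebra.trace (RatFunc F) K (_ / _))) = _
  rw [mul_eq, trace_eq, map_add, map_mul, map_mul, toKInf_algebraMap, toKInf_algebraMap]

theorem exists_abs_sub_sq_le (h : IsImaginaryQuadratic α s v) {z : K} {N : ℕ}
    (hz : ∀ g ∈ ballInt (F := F) v N, traceChar F s (g * z) = 1) :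
    ∃ w : 𝔸, v (z - w) ^ 2 ≤ (Nat.card F : ℝ) ^ ((α.natDegree : ℤ) - N) := by
  obtain ⟨x, y, rfl⟩ := h.exists_eq_add_mul z
  have hx : ∀ r ∈ degreeLT F ((N + 2 - α.natDegree) / 2),
      charInf (polyToKInf F r * toKInf F x) = 1 := by
    intro r hr
    rw [← hz _ (h.toInt_mem_ballInt_iff.mpr ⟨zero_mem _, hr⟩), traceChar_toInt_mul, map_zero,
      zero_mul, zero_add]
  have hy : ∀ p ∈ degreeLT F ((N + 2) / 2), charInf (polyToKInf F p * toKInf F y) = 1 := by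
    intro p hp
    rw [← hz _ (h.toInt_mem_ballInt_iff.mpr ⟨hp, zero_mem _⟩), traceChar_toInt_mul, map_zero,
      zero_mul, add_zero]
  obtain ⟨p, hp⟩ := exists_absInf_sub_le_of_charInf_mul_eq_one hx
  obtain ⟨r, hr⟩ := exists_absInf_sub_le_of_charInf_mul_eq_one hy
  have sub_toInt : ι x + ι y * s - h.toInt p r = ι (x - κ p) + ι (y - κ r) * s := by
    rw [coe_toInt, map_sub, map_sub]
    ring
  have hq := one_lt_card F
  have hq0 : (Nat.card F : ℝ) ≠ 0 := by positivity
  refine ⟨h.toInt p r, ?_⟩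
  rw [sub_toInt, h.abs_sq_add_mul, map_sub, map_sub, toKInf_algebraMap, toKInf_algebraMap]
  apply max_le
  · refine (pow_le_pow_left₀ (absInf_nonneg _) hp 2).trans ?_
    rw [← zpow_natCast, ← zpow_mul, zpow_le_zpow_iff_right₀ hq]
    push_cast
    omega
  · refine (mul_le_mul_of_nonneg_left (pow_le_pow_left₀ (absInf_nonneg _) hr 2)
      (by positivity)).trans ?_
    rw [← zpow_natCast, ← zpow_natCast, ← zpow_mul, ← zpow_add₀ hq0, zpow_le_zpow_iff_right₀ hq]
    push_cast
    omega

end Duality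

section DivisorBound

theorem moduleFinite (h : IsImaginaryQuadratic α s v) : Module.Finite F[X] 𝔸 := by
  have := h.finiteDimensional
  have := h.isSeparable
  exact IsIntegralClosure.finite F[X] (RatFunc F) K 𝔸

theorem isDedekindDomain (h : IsImaginaryQuadratic α s v) : IsDedekindDomain 𝔸 := by
  have := h.finiteDimensional
  have := h.isSeparable
  exact integralClosure.isDedekindDomain F[X] (RatFunc F) K

theorem finite_quotient (h : IsImaginaryQuadratic α s v) {m : 𝔸} (hm : m ≠ 0) :
    Finite (𝔸 ⧸ Ideal.span {m}) := by
  have := h.moduleFinite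
  have := hasFiniteQuotients_polynomial F
  have := Ring.HasFiniteQuotients.of_module_finite F[X] 𝔸
  exact Ring.HasFiniteQuotients.finiteQuotient (by rwa [Ne, Ideal.span_singleton_eq_bot])

theorem abs_sq_eq_pow_normDegree (h : IsImaginaryQuadratic α s v) [IsDedekindDomain 𝔸]
    [Module.Finite F[X] 𝔸] [Module.IsTorsionFree F[X] 𝔸] {x : 𝔸} (hx : x ≠ 0) :
    v (x : K) ^ 2 = (Nat.card F : ℝ) ^ normDegree F (Ideal.span {x}) := by
  have := h.finiteDimensional
  have relNorm_eq : Ideal.relNorm F[X] (Ideal.span {x}) = Ideal.span {Algebra.intNorm F[X] 𝔸 x} :=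
    Ideal.relNorm_singleton F[X] x
  have intNorm_ne_zero : Algebra.intNorm F[X] 𝔸 x ≠ 0 := by
    intro h0
    rw [h0, Ideal.span_singleton_eq_bot.mpr rfl, Ideal.relNorm_eq_bot_iff,
      Ideal.span_singleton_eq_bot] at relNorm_eq
    exact hx relNorm_eq
  rw [normDegree_eq_natDegree relNorm_eq, h.abs_sq_eq_absInf_norm,
    show (x : K) = algebraMap 𝔸 K x from rfl,
    ← Algebra.algebraMap_intNorm (A := F[X]) (K := RatFunc F) (L := K) x, toKInf_algebraMap,
    absInf_polyToKInf intNorm_ne_zero]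

theorem one_le_abs_sq (h : IsImaginaryQuadratic α s v) {x : 𝔸} (hx : x ≠ 0) :
    1 ≤ v (x : K) ^ 2 := by
  have := h.moduleFinite
  have := h.isDedekindDomain
  have := isTorsionFree_integralClosure F[X] (RatFunc F) K
  rw [h.abs_sq_eq_pow_normDegree hx]
  exact one_le_pow₀ (one_lt_card F).le

theorem coe_unit_mem_ballInt_zero (h : IsImaginaryQuadratic α s v) (u : 𝔸ˣ) :
    (u : 𝔸) ∈ ballInt v 0 := by
  have abs_mul_inv : v ((u : 𝔸) : K) ^ 2 * v ((↑u⁻¹ : 𝔸) : K) ^ 2 = 1 := by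
    rw [← mul_pow, ← map_mul, ← Subalgebra.coe_mul, Units.mul_inv, Subalgebra.coe_one, map_one,
      one_pow]
  rw [ballInt, Set.mem_ofPred_eq, pow_zero, ← abs_mul_inv]
  exact le_mul_of_one_le_right (sq_nonneg _) (h.one_le_abs_sq u⁻¹.ne_zero)

theorem finite_units (h : IsImaginaryQuadratic α s v) : Finite 𝔸ˣ := by
  have := (h.finite_ballInt 0).to_subtype
  exact Finite.of_injective
    (fun u : 𝔸ˣ => (⟨u, h.coe_unit_mem_ballInt_zero u⟩ : ballInt (F := F) v 0))
    fun u w huw => Units.ext (Subtype.ext_iff.mp huw)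

theorem card_units_le (h : IsImaginaryQuadratic α s v) : Nat.card 𝔸ˣ ≤ Nat.card F ^ 2 := by
  rw [← Set.ncard_univ]
  exact (Set.ncard_le_ncard_of_injOn _ (fun u _ => h.coe_unit_mem_ballInt_zero u)
    Units.val_injective.injOn (h.finite_ballInt 0)).trans (h.ncard_ballInt_le 0)

theorem ncard_dvd_le (h : IsImaginaryQuadratic α s v) {m : 𝔸} (hm : m ≠ 0) {Q : ℕ}
    (hmQ : m ∈ ballInt v (2 * Q)) :
    {u | u ∣ m}.ncard ≤ Nat.card F ^ 2 * (4 ^ Nat.card F * 2 ^ Q) := by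
  have := h.moduleFinite
  have := h.isDedekindDomain
  have := isTorsionFree_integralClosure F[X] (RatFunc F) K
  have := h.finite_units
  have hq := one_lt_card F
  have normDegree_X_sub_C (c : F) :
      normDegree F (Ideal.span {algebraMap F[X] 𝔸 (X - C c)}) ≤ 2 := by
    have ne_zero : algebraMap F[X] 𝔸 (X - C c) ≠ 0 :=
      (map_ne_zero_iff _ (FaithfulSMul.algebraMap_injective _ _)).mpr (X_sub_C_ne_zero c)
    rw [← pow_le_pow_iff_right₀ hq, ← h.abs_sq_eq_pow_normDegree ne_zero,
      show ((algebraMap F[X] 𝔸 (X - C c) : 𝔸) : K) = algebraMap F[X] K (X - C c) from rfl,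
      IsScalarTower.algebraMap_apply F[X] (RatFunc F) K, h.abs_algebraMap, toKInf_algebraMap,
      absInf_polyToKInf (X_sub_C_ne_zero c), natDegree_X_sub_C, pow_one]
  have ncard_ideal_dvd_le : {J | J ∣ Ideal.span {m}}.ncard ≤ 4 ^ Nat.card F * 2 ^ Q := by
    rw [← Nat.pow_le_pow_iff_left _root_.two_ne_zero, mul_pow, ← pow_mul, ← pow_mul]
    refine (ncard_ideal_dvd_sq_le normDegree_X_sub_C
      (by rwa [Ne, Ideal.span_singleton_eq_bot])).trans ?_
    gcongr
    · norm_num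
    · rwa [ballInt, Set.mem_ofPred_eq, h.abs_sq_eq_pow_normDegree hm, pow_le_pow_iff_right₀ hq,
        mul_comm] at hmQ
  exact (ncard_dvd_le_mul_ncard_ideal_dvd hm).trans
    (Nat.mul_le_mul h.card_units_le ncard_ideal_dvd_le)

end DivisorBound

end IsImaginaryQuadratic

section NearIntegers

variable (F : Type*) {K : Type*} [Field F] [Field K] [Algebra F[X] K]

/-- `x` is near the integers of `K`, within distance `q ^ (e / 2)`. -/
def IsNearInt (v : AbsoluteValue K ℝ) (e : ℤ) (x : K) : Prop :=
  ∃ r : integralClosure F[X] K, v (x - r) ^ 2 ≤ (Nat.card F : ℝ) ^ e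

/-- The moduli `f` for which `f² x` is near the integers. For `x = r₀ / f₀²` these are the `f` for
which some fraction `r / f²` is close to `x` modulo `𝔸`. -/
def nearModuli (v : AbsoluteValue K ℝ) (Q : ℕ) (e : ℤ) (x : K) : Set (integralClosure F[X] K) :=
  {f ∈ moduli v Q | IsNearInt F v e ((f : K) ^ 2 * x)}

/-- The indices `(f, r mod f²)` of the sum defining `sieveSum`. -/
abbrev FareyIndex (v : AbsoluteValue K ℝ) (Q : ℕ) : Type _ :=
  Σ f : moduli (F := F) v Q,
    {c : integralClosure F[X] K ⧸ Ideal.span {(f : integralClosure F[X] K) ^ 2} //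
      IsCoprime c.out (f : integralClosure F[X] K)}

variable {F}

/-- The fraction `r / f²`, for the chosen representative `r` of the class modulo `f²`. -/
def FareyIndex.frac {v : AbsoluteValue K ℝ} {Q : ℕ} (i : FareyIndex F v Q) : K :=
  (i.2.1.out : K) / ((i.1 : integralClosure F[X] K) : K) ^ 2

theorem zpow_le_pow_toNat [Finite F] (e : ℤ) :
    (Nat.card F : ℝ) ^ e ≤ (Nat.card F : ℝ) ^ e.toNat := by
  rw [← zpow_natCast]
  exact zpow_le_zpow_right₀ (one_lt_card F).le (Int.self_le_toNat e)

end NearIntegers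

namespace IsImaginaryQuadratic

variable {F K : Type*} [Field F] [Field K] [Algebra F[X] K] [Algebra (RatFunc F) K]
  {α : F[X]} {s : K} {v : AbsoluteValue K ℝ}

local notation "𝔸" => integralClosure (Polynomial F) K

/-- The ball `𝐁(0, N) ∩ 𝔸` as a group. -/
def ballGroup (h : IsImaginaryQuadratic α s v) (N : ℕ) : AddSubgroup 𝔸 where
  carrier := ballInt v N
  add_mem' hx hy := h.abs_sq_add_le hx hy
  zero_mem' := by simp [ballInt]
  neg_mem' := by simp [ballInt]

variable [Finite F]

/-- The character `g ↦ e(Tr(g x / (2 s)))` of `𝐁(0, N) ∩ 𝔸`. -/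
def pairingChar (h : IsImaginaryQuadratic α s v) (N : ℕ) (x : K) : AddChar (h.ballGroup N) ℂ :=
  (traceChar F s).compAddMonoidHom
    ((AddMonoidHom.mulRight x).comp ((Subalgebra.val 𝔸 : 𝔸 →+ K).comp (h.ballGroup N).subtype))

theorem pairingChar_apply (h : IsImaginaryQuadratic α s v) {N : ℕ} (x : K) (g : h.ballGroup N) :
    h.pairingChar N x g = traceChar F s ((g : 𝔸) * x) :=
  rfl

theorem expSum_eq_sum (h : IsImaginaryQuadratic α s v) {N : ℕ} [Fintype (h.ballGroup N)]
    (a : 𝔸 → ℂ) (f r : 𝔸) :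
    expSum v s N a f r = ∑ g : h.ballGroup N, a g * h.pairingChar N ((r : K) / (f : K) ^ 2) g := by
  have term_eq (g : 𝔸) : a g * charInf (toKInf F (Algebra.trace (RatFunc F) K
      ((g : K) * (r : K) / (2 * s * (f : K) ^ 2)))) =
        a g * traceChar F s ((g : K) * ((r : K) / (f : K) ^ 2)) := by
    rw [mul_comm (2 * s), ← div_div, mul_div_assoc]
    rfl
  simp only [expSum, term_eq, pairingChar_apply]
  rw [← finsum_eq_sum_of_fintype]
  exact (finsum_set_coe_eq_finsum_mem (ballInt (F := F) v N)).symm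

variable [IsScalarTower F[X] (RatFunc F) K]

theorem exists_abs_sub_sq_le_of_pairingChar_eq (h : IsImaginaryQuadratic α s v) {N : ℕ} {x y : K}
    (hxy : h.pairingChar N x = h.pairingChar N y) :
    ∃ w : 𝔸, v (x - y - w) ^ 2 ≤ (Nat.card F : ℝ) ^ ((α.natDegree : ℤ) - N) := by
  refine h.exists_abs_sub_sq_le fun g hg => ?_
  have apply_eq := DFunLike.congr_fun hxy (⟨g, hg⟩ : h.ballGroup N)
  rw [pairingChar_apply, pairingChar_apply] at apply_eq
  rw [mul_sub, AddChar.map_sub_eq_div, apply_eq, div_self ((traceChar F s).val_isUnit _).ne_zero]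

theorem exists_mk_eq_of_pairingChar_eq (h : IsImaginaryQuadratic α s v) {Q N : ℕ} {f : 𝔸}
    (hf : f ∈ moduli v Q) {x : K} {c : 𝔸 ⧸ Ideal.span {f ^ 2}}
    (hc : h.pairingChar N ((c.out : K) / (f : K) ^ 2) = h.pairingChar N x) :
    ∃ r : 𝔸, Ideal.Quotient.mk _ r = c ∧
      v ((f : K) ^ 2 * x - r) ^ 2 ≤ (Nat.card F : ℝ) ^ (2 * (Q : ℤ) + α.natDegree - N) := by
  have hq := one_lt_card F
  have hf0 : (f : K) ≠ 0 := by simpa using hf.1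
  obtain ⟨w, hw⟩ := h.exists_abs_sub_sq_le_of_pairingChar_eq hc
  refine ⟨c.out - w * f ^ 2, ?_, ?_⟩
  · refine Eq.trans (Ideal.Quotient.eq.mpr ?_) (Quotient.out_eq c)
    exact Ideal.mem_span_singleton.mpr ⟨-w, by ring⟩
  · have factor : (f : K) ^ 2 * x - ((c.out - w * f ^ 2 : 𝔸) : K) =
        -((f : K) ^ 2 * ((c.out : K) / (f : K) ^ 2 - x - w)) := by
      push_cast
      field_simp
      ring
    rw [factor, v.map_neg, map_mul, map_pow, mul_pow, hf.2, add_sub_assoc,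
      zpow_add₀ (by positivity), mul_comm 2 (Q : ℤ), zpow_mul, zpow_natCast]
    exact mul_le_mul_of_nonneg_left hw (by positivity)

theorem ncard_pairingChar_eq_le (h : IsImaginaryQuadratic α s v) {Q N : ℕ} {f : 𝔸}
    (hf : f ∈ moduli v Q) (x : K) :
    {c : 𝔸 ⧸ Ideal.span {f ^ 2} |
      h.pairingChar N ((c.out : K) / (f : K) ^ 2) = h.pairingChar N x}.ncard ≤
      Nat.card F ^ ((2 * (Q : ℤ) + α.natDegree - N).toNat + 2) := by
  set T := {c : 𝔸 ⧸ Ideal.span {f ^ 2} |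
      h.pairingChar N ((c.out : K) / (f : K) ^ 2) = h.pairingChar N x}
  set M := (2 * (Q : ℤ) + α.natDegree - N).toNat
  rcases T.eq_empty_or_nonempty with hT | ⟨c₁, hc₁⟩
  · rw [hT, Set.ncard_empty]
    exact Nat.zero_le _
  obtain ⟨r₁, -, hr₁⟩ := h.exists_mk_eq_of_pairingChar_eq hf hc₁
  have subset_image : T ⊆ (fun b : 𝔸 => Ideal.Quotient.mk (Ideal.span {f ^ 2}) (r₁ - b)) ''
      ballInt v M := by
    intro c hc
    obtain ⟨r, hrc, hr⟩ := h.exists_mk_eq_of_pairingChar_eq hf hc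
    refine ⟨r₁ - r, ?_, by rw [← hrc]; exact congrArg _ (sub_sub_cancel r₁ r)⟩
    have sub_eq : ((r₁ - r : 𝔸) : K) = ((f : K) ^ 2 * x - r) - ((f : K) ^ 2 * x - r₁) := by
      push_cast
      ring
    rw [ballInt, Set.mem_ofPred_eq, sub_eq]
    exact (h.abs_sq_sub_le hr hr₁).trans (zpow_le_pow_toNat _)
  calc T.ncard ≤ _ := Set.ncard_le_ncard subset_image ((h.finite_ballInt M).image _)
    _ ≤ _ := Set.ncard_image_le (h.finite_ballInt M)
    _ ≤ _ := h.ncard_ballInt_le M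

theorem finite_fareyIndex (h : IsImaginaryQuadratic α s v) (Q : ℕ) : Finite (FareyIndex F v Q) := by
  have := (h.finite_moduli Q).to_subtype
  have (f : moduli (F := F) v Q) : Finite (𝔸 ⧸ Ideal.span {(f : 𝔸) ^ 2}) :=
    h.finite_quotient (pow_ne_zero 2 f.2.1)
  infer_instance

theorem sieveSum_eq_sum (h : IsImaginaryQuadratic α s v) (Q : ℕ) {N : ℕ} (a : 𝔸 → ℂ)
    [Fintype (FareyIndex F v Q)] [Fintype (h.ballGroup N)] :
    sieveSum v s Q N a = ∑ i : FareyIndex F v Q,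
      ‖∑ g : h.ballGroup N, a g * h.pairingChar N i.frac g‖ ^ 2 := by
  have := (h.finite_moduli Q).fintype
  have (f : moduli (F := F) v Q) :
      Fintype {c : 𝔸 ⧸ Ideal.span {(f : 𝔸) ^ 2} // IsCoprime c.out (f : 𝔸)} :=
    have := h.finite_quotient (pow_ne_zero 2 f.2.1)
    Fintype.ofFinite _
  calc sieveSum v s Q N a = ∑ f : moduli (F := F) v Q,
        ∑ c : {c : 𝔸 ⧸ Ideal.span {(f : 𝔸) ^ 2} // IsCoprime c.out (f : 𝔸)},
          ‖expSum v s N a f c.1.out‖ ^ 2 := by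
        rw [sieveSum, ← finsum_set_coe_eq_finsum_mem (moduli (F := F) v Q),
          finsum_eq_sum_of_fintype]
        refine Finset.sum_congr rfl fun f _ => ?_
        exact (finsum_subtype_eq_finsum_cond
          fun c : 𝔸 ⧸ Ideal.span {(f : 𝔸) ^ 2} => IsCoprime c.out (f : 𝔸)).symm.trans
            (finsum_eq_sum_of_fintype _)
    _ = ∑ i : FareyIndex F v Q, ‖expSum v s N a i.1 i.2.1.out‖ ^ 2 := by
        rw [← Fintype.sum_sigma']
        convert rfl
    _ = _ := Finset.sum_congr rfl fun i _ => by rw [h.expSum_eq_sum, FareyIndex.frac]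

theorem finite_nearModuli (h : IsImaginaryQuadratic α s v) (Q : ℕ) (e : ℤ) (x : K) :
    (nearModuli F v Q e x).Finite :=
  (h.finite_moduli Q).subset (Set.sep_subset _ _)

theorem ncard_pairingChar_frac_eq_le (h : IsImaginaryQuadratic α s v) {Q N : ℕ} (x : K) :
    {i : FareyIndex F v Q | h.pairingChar N i.frac = h.pairingChar N x}.ncard ≤
      Nat.card F ^ ((2 * (Q : ℤ) + α.natDegree - N).toNat + 2) *
        (nearModuli F v Q (2 * (Q : ℤ) + α.natDegree - N) x).ncard := by
  have := h.finite_fareyIndex Q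
  refine ncard_le_mul_ncard_of_mapsTo (fun i : FareyIndex F v Q => (i.1 : 𝔸)) (Set.toFinite _)
    (h.finite_nearModuli Q _ x) ?_ _ ?_
  · rintro ⟨f, c⟩ hfc
    obtain ⟨r, -, hr⟩ := h.exists_mk_eq_of_pairingChar_eq f.2 hfc
    exact ⟨f.2, r, hr⟩
  · intro f hf
    have := h.finite_quotient (pow_ne_zero 2 hf.1.1)
    refine le_trans ?_ (h.ncard_pairingChar_eq_le hf.1 x)
    have subset_image : {i : FareyIndex F v Q |
        h.pairingChar N i.frac = h.pairingChar N x ∧ (i.1 : 𝔸) = f} ⊆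
        Sigma.mk ⟨f, hf.1⟩ '' {c | h.pairingChar N ((c.1.out : K) / (f : K) ^ 2) =
          h.pairingChar N x} := by
      rintro ⟨⟨_, _⟩, c⟩ ⟨hc, rfl⟩
      exact ⟨c, hc, rfl⟩
    calc _ ≤ _ := Set.ncard_le_ncard subset_image (Set.toFinite _)
      _ ≤ _ := Set.ncard_image_le (Set.toFinite _)
      _ ≤ _ := Set.ncard_le_ncard_of_injOn Subtype.val (fun _ hc => hc)
        Subtype.val_injective.injOn (Set.toFinite _)

theorem sieveSum_le (h : IsImaginaryQuadratic α s v) {Q N : ℕ} (a : 𝔸 → ℂ) {A : ℝ} (hA0 : 0 ≤ A)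
    (hA : ∀ f₀ ∈ moduli (F := F) v Q, ∀ r₀ : 𝔸, IsCoprime r₀ f₀ →
      (nearModuli F v Q (2 * (Q : ℤ) + α.natDegree - N) ((r₀ : K) / (f₀ : K) ^ 2)).ncard ≤ A) :
    sieveSum v s Q N a ≤
      A * (Nat.card F : ℝ) ^ ((2 * (Q : ℤ) + α.natDegree - N).toNat + (N + 4)) *
        ∑ᶠ g ∈ ballInt (F := F) v N, ‖a g‖ ^ 2 := by
  have := h.finite_fareyIndex Q
  have := Fintype.ofFinite (FareyIndex F v Q)
  have : Fintype (h.ballGroup N) := (h.finite_ballInt N).fintype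
  have fiber_le (χ : AddChar (h.ballGroup N) ℂ) :
      ({i : FareyIndex F v Q | h.pairingChar N i.frac = χ}.ncard : ℝ) ≤
        (Nat.card F : ℝ) ^ ((2 * (Q : ℤ) + α.natDegree - N).toNat + 2) * A := by
    rcases Set.eq_empty_or_nonempty {i : FareyIndex F v Q | h.pairingChar N i.frac = χ} with
      hempty | ⟨i₀, rfl⟩
    · rw [hempty, Set.ncard_empty, Nat.cast_zero]
      positivity
    · refine le_trans (Nat.cast_le.mpr (h.ncard_pairingChar_frac_eq_le i₀.frac)) ?_
      push_cast
      gcongr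
      exact hA i₀.1 i₀.1.2 _ i₀.2.2
  have card_le : (Fintype.card (h.ballGroup N) : ℝ) ≤ (Nat.card F : ℝ) ^ (N + 2) := by
    rw [← Nat.card_eq_fintype_card]
    exact_mod_cast h.ncard_ballInt_le N
  have sum_eq : ∑ᶠ g ∈ ballInt (F := F) v N, ‖a g‖ ^ 2 = ∑ g : h.ballGroup N, ‖a g‖ ^ 2 := by
    rw [← finsum_eq_sum_of_fintype, ← finsum_set_coe_eq_finsum_mem (ballInt (F := F) v N)]
    rfl
  rw [h.sieveSum_eq_sum, sum_eq]
  calc _ ≤ _ := sum_norm_sq_le_of_ncard_fiber_le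
        (fun i : FareyIndex F v Q => h.pairingChar N i.frac) fiber_le fun g => a g
    _ ≤ (Nat.card F : ℝ) ^ ((2 * (Q : ℤ) + α.natDegree - N).toNat + 2) * A *
        ((Nat.card F : ℝ) ^ (N + 2) * ∑ g : h.ballGroup N, ‖a g‖ ^ 2) := by gcongr
    _ = _ := by ring

end IsImaginaryQuadratic

section NearMultipliers

variable (F : Type*) {K : Type*} [Field F] [Field K] [Algebra F[X] K]

/-- The multipliers `m` with `|m|² ≤ q ^ (2 Q)` for which `m x` is near the integers; they contain
the differences of squares of elements of `nearModuli F v Q e x`. -/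
def nearMultipliers (v : AbsoluteValue K ℝ) (Q : ℕ) (e : ℤ) (x : K) :
    Set (integralClosure F[X] K) :=
  {m ∈ ballInt v (2 * Q) | IsNearInt F v e (m * x)}

end NearMultipliers

namespace IsImaginaryQuadratic

variable {F K : Type*} [Field F] [Field K] [Algebra F[X] K] [Algebra (RatFunc F) K]
  {α : F[X]} {s : K} {v : AbsoluteValue K ℝ}

local notation "𝔸" => integralClosure (Polynomial F) K

theorem isNearInt_sub (h : IsImaginaryQuadratic α s v) {e : ℤ} {x y : K}
    (hx : IsNearInt F v e x) (hy : IsNearInt F v e y) : IsNearInt F v e (x - y) := by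
  obtain ⟨r, hr⟩ := hx
  obtain ⟨r', hr'⟩ := hy
  refine ⟨r - r', ?_⟩
  rw [AddSubgroupClass.coe_sub, sub_sub_sub_comm]
  exact h.abs_sq_sub_le hr hr'

theorem sq_sub_sq_mem_nearMultipliers (h : IsImaginaryQuadratic α s v) {Q : ℕ} {e : ℤ} {x : K}
    {f g : 𝔸} (hf : f ∈ nearModuli F v Q e x) (hg : g ∈ nearModuli F v Q e x) :
    f ^ 2 - g ^ 2 ∈ nearMultipliers F v Q e x := by
  have abs_sq_sq_le {f : 𝔸} (hf : f ∈ moduli v Q) :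
      v ((f : K) ^ 2) ^ 2 ≤ (Nat.card F : ℝ) ^ (2 * Q) := by
    rw [map_pow, hf.2, ← pow_mul, mul_comm]
  refine ⟨?_, ?_⟩
  · rw [ballInt, Set.mem_ofPred_eq]
    push_cast
    exact h.abs_sq_sub_le (abs_sq_sq_le hf.1) (abs_sq_sq_le hg.1)
  · push_cast
    rw [sub_mul]
    exact h.isNearInt_sub hf.2 hg.2

variable [IsScalarTower F[X] (RatFunc F) K] [Finite F]

theorem finite_nearMultipliers (h : IsImaginaryQuadratic α s v) (Q : ℕ) (e : ℤ) (x : K) :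
    (nearMultipliers F v Q e x).Finite :=
  (h.finite_ballInt (2 * Q)).subset (Set.sep_subset _ _)

theorem ncard_ballInt_inter_dvd_sub_le (h : IsImaginaryQuadratic α s v) {Q : ℕ} {f : 𝔸}
    (hf : f ∈ moduli v Q) (m₁ : 𝔸) :
    {m ∈ ballInt v (2 * Q) | f ^ 2 ∣ m - m₁}.ncard ≤ Nat.card F ^ 2 := by
  have hq := one_lt_card F
  set S := {m ∈ ballInt v (2 * Q) | f ^ 2 ∣ m - m₁}
  rcases S.eq_empty_or_nonempty with hS | ⟨m₂, hm₂, hdvd₂⟩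
  · rw [hS, Set.ncard_empty]
    exact Nat.zero_le _
  have subset_image : S ⊆ (fun k => m₂ + f ^ 2 * k) '' ballInt v 0 := by
    rintro m ⟨hm, hdvd⟩
    obtain ⟨k, hk⟩ : f ^ 2 ∣ m - m₂ := by simpa using dvd_sub hdvd hdvd₂
    refine ⟨k, ?_, by linear_combination -hk⟩
    have abs_sq_le : v ((m - m₂ : 𝔸) : K) ^ 2 ≤ (Nat.card F : ℝ) ^ (2 * Q) := by
      push_cast
      exact h.abs_sq_sub_le hm hm₂
    rw [hk] at abs_sq_le
    push_cast at abs_sq_le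
    rw [map_mul, map_pow, mul_pow, hf.2, ← pow_mul, mul_comm Q] at abs_sq_le
    rw [ballInt, Set.mem_ofPred_eq, pow_zero]
    exact le_of_mul_le_mul_left (by rwa [mul_one]) (by positivity)
  calc S.ncard ≤ _ := Set.ncard_le_ncard subset_image ((h.finite_ballInt 0).image _)
    _ ≤ _ := Set.ncard_image_le (h.finite_ballInt 0)
    _ ≤ _ := h.ncard_ballInt_le 0

theorem ncard_nearMultipliers_le (h : IsImaginaryQuadratic α s v) {Q : ℕ} (e : ℤ) {f₀ r₀ : 𝔸}
    (hf₀ : f₀ ∈ moduli v Q) (hr₀ : IsCoprime r₀ f₀) :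
    (nearMultipliers F v Q e ((r₀ : K) / (f₀ : K) ^ 2)).ncard ≤
      Nat.card F ^ 2 * Nat.card F ^ ((2 * (Q : ℤ) + e).toNat + 2) := by
  have hq := one_lt_card F
  set T := nearMultipliers F v Q e ((r₀ : K) / (f₀ : K) ^ 2)
  have hf0 : (f₀ : K) ≠ 0 := by simpa using hf₀.1
  have near (m : 𝔸) (hm : m ∈ T) : ∃ r : 𝔸, v ((m : K) * ((r₀ : K) / (f₀ : K) ^ 2) - r) ^ 2 ≤
      (Nat.card F : ℝ) ^ e := hm.2
  choose! ρ hρ using near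
  refine (ncard_le_mul_ncard_of_mapsTo (fun m => m * r₀ - ρ m * f₀ ^ 2)
    (h.finite_nearMultipliers Q e _) (h.finite_ballInt (2 * (Q : ℤ) + e).toNat) ?_
    (Nat.card F ^ 2) ?_).trans (Nat.mul_le_mul_left _ (h.ncard_ballInt_le _))
  · intro m hm
    have factor : ((m * r₀ - ρ m * f₀ ^ 2 : 𝔸) : K) =
        (f₀ : K) ^ 2 * ((m : K) * ((r₀ : K) / (f₀ : K) ^ 2) - ρ m) := by
      push_cast
      field_simp
    rw [ballInt, Set.mem_ofPred_eq, factor, map_mul, map_pow, mul_pow, hf₀.2]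
    refine le_trans ?_ (zpow_le_pow_toNat _)
    rw [zpow_add₀ (by positivity), mul_comm 2 (Q : ℤ), zpow_mul, zpow_natCast]
    exact mul_le_mul_of_nonneg_left (hρ m hm) (by positivity)
  · rintro b -
    rcases Set.eq_empty_or_nonempty {m | m ∈ T ∧ m * r₀ - ρ m * f₀ ^ 2 = b} with
      hempty | ⟨m₁, -, hm₁⟩
    · rw [hempty, Set.ncard_empty]
      exact Nat.zero_le _
    · refine le_trans (Set.ncard_le_ncard ?_ ((h.finite_ballInt (2 * Q)).subset
        (Set.sep_subset _ _))) (h.ncard_ballInt_inter_dvd_sub_le hf₀ m₁)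
      rintro m ⟨hmT, hm⟩
      refine ⟨hmT.1, hr₀.symm.pow_left.dvd_of_dvd_mul_right ⟨ρ m - ρ m₁, ?_⟩⟩
      linear_combination hm - hm₁

theorem ncard_nearModuli_sq_le (h : IsImaginaryQuadratic α s v) {Q : ℕ} (e : ℤ) {f₀ r₀ : 𝔸}
    (hf₀ : f₀ ∈ moduli v Q) (hr₀ : IsCoprime r₀ f₀) :
    (nearModuli F v Q e ((r₀ : K) / (f₀ : K) ^ 2)).ncard ^ 2 ≤
      2 * (nearModuli F v Q e ((r₀ : K) / (f₀ : K) ^ 2)).ncard +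
        Nat.card F ^ 2 * (4 ^ Nat.card F * 2 ^ Q) *
          (Nat.card F ^ 2 * Nat.card F ^ ((2 * (Q : ℤ) + e).toNat + 2)) := by
  have := h.isDedekindDomain
  have := h.finite_units
  have two_ne_zero_int : (2 : 𝔸) ≠ 0 := fun h0 => h.two_ne_zero (congrArg Subtype.val h0)
  refine (ncard_sq_le_of_sq_sub_sq_mem two_ne_zero_int (h.finite_nearModuli Q e _)
    (h.finite_nearMultipliers Q e _) (fun f hf g hg => h.sq_sub_sq_mem_nearMultipliers hf hg)
    (fun m _ hm => finite_setOf_dvd hm) (fun m hmT hm => h.ncard_dvd_le hm hmT.1)).trans ?_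
  gcongr
  exact h.ncard_nearMultipliers_le e hf₀ hr₀

end IsImaginaryQuadratic

section RealEstimates

theorem le_two_add_of_sq_le {x y : ℝ} (hy : 0 ≤ y) (h : x ^ 2 ≤ 2 * x + y ^ 2) : x ≤ 2 + y := by
  have sq_le : (x - 1) ^ 2 ≤ (1 + y) ^ 2 := by linarith
  linarith [le_abs_self (x - 1), abs_le_of_sq_le_sq sq_le (by linarith)]

theorem sqrt_two_pow_le {Q N : ℕ} (hN : 2 * Q ≤ N) :
    √((2 : ℝ) ^ Q) ≤ 2 ^ (((N : ℝ) - Q) / 2) := by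
  have hNQ : (2 * Q : ℝ) ≤ N := by exact_mod_cast hN
  rw [Real.sqrt_eq_rpow, ← Real.rpow_natCast, ← Real.rpow_mul zero_le_two]
  exact Real.rpow_le_rpow_of_exponent_le one_le_two (by linarith)

variable {q : ℝ}

theorem sqrt_pow_toNat_le (hq : 1 ≤ q) (d Q N : ℕ) :
    √(q ^ (4 * (Q : ℤ) + d - N).toNat) ≤ q ^ d * (1 + q ^ (2 * (Q : ℝ) - N / 2)) := by
  have hq0 : 0 < q := by positivity
  have one_le_pow : 1 ≤ q ^ d := one_le_pow₀ hq
  have rpow_pos := Real.rpow_pos_of_pos hq0 (2 * (Q : ℝ) - N / 2)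
  rcases le_or_gt (4 * (Q : ℤ) + d) N with hN | hN
  · rw [Int.toNat_of_nonpos (by omega), pow_zero, Real.sqrt_one]
    exact one_le_mul_of_one_le_of_one_le one_le_pow (by linarith)
  · have cast_toNat : ((4 * (Q : ℤ) + d - N).toNat : ℝ) = 4 * Q + d - N := by
      rw [← Int.cast_natCast, Int.toNat_of_nonneg (by omega)]
      push_cast
      ring
    calc √(q ^ (4 * (Q : ℤ) + d - N).toNat) = q ^ ((d : ℝ) / 2 + (2 * (Q : ℝ) - N / 2)) := by
          rw [← Real.rpow_natCast, cast_toNat, Real.sqrt_eq_rpow, ← Real.rpow_mul hq0.le]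
          congr 1
          ring
      _ = q ^ ((d : ℝ) / 2) * q ^ (2 * (Q : ℝ) - N / 2) := Real.rpow_add hq0 _ _
      _ ≤ q ^ (d : ℝ) * (1 + q ^ (2 * (Q : ℝ) - N / 2)) := by
          gcongr
          · exact half_le_self d.cast_nonneg
          · linarith
      _ = _ := by rw [Real.rpow_natCast]

theorem one_add_rpow_mul_pow_le (hq : 1 ≤ q) (Q N : ℕ) :
    (1 + q ^ (2 * (Q : ℝ) - N / 2)) * q ^ N ≤
      q ^ ((Q : ℝ) / 2 + N) + q ^ (2 * (Q : ℝ) + N / 2) := by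
  rw [add_mul, one_mul, ← Real.rpow_natCast, ← Real.rpow_add (by positivity)]
  refine add_le_add (Real.rpow_le_rpow_of_exponent_le hq ?_) (le_of_eq (congrArg _ ?_))
  · exact le_add_of_nonneg_left (by positivity)
  · ring

end RealEstimates

namespace IsImaginaryQuadratic

variable {F K : Type*} [Field F] [Field K] [Algebra F[X] K] [Algebra (RatFunc F) K]
  {α : F[X]} {s : K} {v : AbsoluteValue K ℝ} [IsScalarTower F[X] (RatFunc F) K] [Finite F]

local notation "𝔸" => integralClosure (Polynomial F) K

theorem ncard_nearModuli_le (h : IsImaginaryQuadratic α s v) {Q : ℕ} (e : ℤ) {f₀ r₀ : 𝔸}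
    (hf₀ : f₀ ∈ moduli v Q) (hr₀ : IsCoprime r₀ f₀) :
    ((nearModuli F v Q e ((r₀ : K) / (f₀ : K) ^ 2)).ncard : ℝ) ≤
      2 + (Nat.card F : ℝ) ^ 3 * 2 ^ Nat.card F *
        (√(2 ^ Q) * √((Nat.card F : ℝ) ^ (2 * (Q : ℤ) + e).toNat)) := by
  apply le_two_add_of_sq_le (by positivity)
  have sq_le := Nat.cast_le (α := ℝ).mpr (h.ncard_nearModuli_sq_le e hf₀ hr₀)
  push_cast at sq_le
  refine sq_le.trans_eq ?_
  rw [mul_pow, mul_pow (√_), Real.sq_sqrt (by positivity), Real.sq_sqrt (by positivity),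
    mul_pow, ← pow_mul 2, mul_comm (Nat.card F), pow_mul 2]
  ring

theorem sieveSum_le_of_le (h : IsImaginaryQuadratic α s v) {Q N : ℕ} (hN : N ≤ 2 * Q)
    (a : 𝔸 → ℂ) :
    sieveSum v s Q N a ≤ (Nat.card F : ℝ) ^ (α.natDegree + 6) * (Nat.card F : ℝ) ^ (3 * Q) *
      ∑ᶠ g ∈ ballInt (F := F) v N, ‖a g‖ ^ 2 := by
  refine (h.sieveSum_le a (by positivity) fun f₀ _ r₀ _ =>
    show _ ≤ (Nat.card F : ℝ) ^ (Q + 2) from ?_).trans_eq ?_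
  · have subset_ballInt : nearModuli F v Q (2 * (Q : ℤ) + α.natDegree - N)
        ((r₀ : K) / (f₀ : K) ^ 2) ⊆ ballInt v Q :=
      (Set.sep_subset _ _).trans (moduli_subset_ballInt v Q)
    exact_mod_cast (Set.ncard_le_ncard subset_ballInt (h.finite_ballInt Q)).trans
      (h.ncard_ballInt_le Q)
  · rw [← pow_add, ← pow_add]
    congr 2
    omega

theorem sieveSum_le_of_ge (h : IsImaginaryQuadratic α s v) {Q N : ℕ} (hN : 2 * Q ≤ N)
    (a : 𝔸 → ℂ) :
    sieveSum v s Q N a ≤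
      (2 + (Nat.card F : ℝ) ^ (α.natDegree + 3) * 2 ^ Nat.card F) *
        (Nat.card F : ℝ) ^ (α.natDegree + 4) *
      ((2 : ℝ) ^ (((N : ℝ) - Q) / 2) * ((Nat.card F : ℝ) ^ ((Q : ℝ) / 2 + N) +
        (Nat.card F : ℝ) ^ (2 * (Q : ℝ) + N / 2))) *
      ∑ᶠ g ∈ ballInt (F := F) v N, ‖a g‖ ^ 2 := by
  have hq := one_lt_card F
  set q : ℝ := (Nat.card F : ℝ)
  set d := α.natDegree
  set W : ℝ := 2 ^ (((N : ℝ) - Q) / 2)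
  set Z : ℝ := 1 + q ^ (2 * (Q : ℝ) - N / 2)
  have one_le_WZ : 1 ≤ W * Z := one_le_mul_of_one_le_of_one_le
    ((Real.one_le_sqrt.mpr (one_le_pow₀ one_le_two)).trans (sqrt_two_pow_le hN))
    (le_add_of_nonneg_right (by positivity))
  have near_le (f₀) (hf₀ : f₀ ∈ moduli (F := F) v Q) (r₀ : 𝔸) (hr₀ : IsCoprime r₀ f₀) :
      (nearModuli F v Q (2 * (Q : ℤ) + d - N) ((r₀ : K) / (f₀ : K) ^ 2)).ncard ≤
        (2 + q ^ (d + 3) * 2 ^ Nat.card F) * (W * Z) := by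
    have sqrt_le := sqrt_pow_toNat_le hq.le d Q N
    rw [show 4 * (Q : ℤ) + d - N = 2 * Q + (2 * Q + d - N) by ring] at sqrt_le
    calc _ ≤ _ := h.ncard_nearModuli_le (2 * (Q : ℤ) + d - N) hf₀ hr₀
      _ ≤ 2 * (W * Z) + q ^ 3 * 2 ^ Nat.card F * (W * (q ^ d * Z)) := by
          gcongr
          · exact le_mul_of_one_le_right zero_le_two one_le_WZ
          · exact sqrt_two_pow_le hN
      _ = _ := by ring
  refine (h.sieveSum_le a (by positivity) near_le).trans
    (mul_le_mul_of_nonneg_right ?_ (finsum_nonneg fun _ => finsum_nonneg fun _ => sq_nonneg _))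
  calc _ ≤ (2 + q ^ (d + 3) * 2 ^ Nat.card F) * (W * Z) * q ^ (d + (N + 4)) := by
        gcongr
        · exact hq.le
        · omega
    _ = (2 + q ^ (d + 3) * 2 ^ Nat.card F) * q ^ (d + 4) * (W * (Z * q ^ N)) := by ring
    _ ≤ _ := by
        gcongr
        exact one_add_rpow_mul_pow_le hq.le Q N

end IsImaginaryQuadratic

end SquareSieve

end

theorem theorem2 (q d : ℕ) :
    ∃ C : ℝ, 0 < C ∧
      ∀ (F : Type*) [Field F] [Finite F] (_ : Nat.card F = q) (_ : 2 < ringChar F)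
        (α : Polynomial F) (_ : Squarefree α) (_ : α.natDegree = d)
        (_ : Odd α.natDegree ∨ ¬ IsSquare α.leadingCoeff)
        -- `K = k(√α)`, where `k = F(t)` and `s = √α`
        (K : Type*) [Field K] [Algebra (Polynomial F) K] [Algebra (RatFunc F) K]
        [IsScalarTower (Polynomial F) (RatFunc F) K]
        (s : K) (_ : s ^ 2 = algebraMap (Polynomial F) K α)
        (_ : IntermediateField.adjoin (RatFunc F) {s} = ⊤)
        -- the absolute value of a place of `K` above infinity, extending the one on `k`
        (v : AbsoluteValue K ℝ)
        (_ : ∀ x : RatFunc F,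
          v (algebraMap (RatFunc F) K x) = SquareSieve.absInf (SquareSieve.toKInf F x))
        (Q N : ℕ) (a : integralClosure (Polynomial F) K → ℂ),
        -- all the sums below are finite
        (SquareSieve.moduli (F := F) v Q).Finite ∧
        (SquareSieve.ballInt (F := F) v N).Finite ∧
        (∀ f ∈ SquareSieve.moduli (F := F) v Q,
          Finite (integralClosure (Polynomial F) K ⧸ Ideal.span {f ^ 2})) ∧
        SquareSieve.sieveSum v s Q N a ≤
          C * ((q : ℝ) ^ (3 * Q) + (2 : ℝ) ^ (((N : ℝ) - (Q : ℝ)) / 2) *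
              ((q : ℝ) ^ ((Q : ℝ) / 2 + (N : ℝ)) + (q : ℝ) ^ (2 * (Q : ℝ) + (N : ℝ) / 2))) *
            ∑ᶠ g ∈ SquareSieve.ballInt (F := F) v N, ‖a g‖ ^ 2 := by
  refine ⟨(q : ℝ) ^ (d + 6) + (2 + (q : ℝ) ^ (d + 3) * 2 ^ q) * (q : ℝ) ^ (d + 4) + 1,
    by positivity, ?_⟩
  intro F _ _ hF hchar α hsf hd hα K _ _ _ _ s hs hadj v hv Q N a
  have h : SquareSieve.IsImaginaryQuadratic α s v := ⟨hchar, hsf, hα, hs, hadj, hv⟩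
  refine ⟨h.finite_moduli Q, h.finite_ballInt N,
    fun f hf => h.finite_quotient (pow_ne_zero 2 hf.1), ?_⟩
  have sum_nonneg : 0 ≤ ∑ᶠ g ∈ SquareSieve.ballInt (F := F) v N, ‖a g‖ ^ 2 :=
    finsum_nonneg fun _ => finsum_nonneg fun _ => sq_nonneg _
  have const₁_nonneg : 0 ≤ (q : ℝ) ^ (d + 6) := by positivity
  have const₂_nonneg : 0 ≤ (2 + (q : ℝ) ^ (d + 3) * 2 ^ q) * (q : ℝ) ^ (d + 4) := by positivity
  subst hF hd
  rcases le_total N (2 * Q) with hN | hN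
  · refine (h.sieveSum_le_of_le hN a).trans ?_
    gcongr
    · linarith
    · exact le_add_of_nonneg_right (by positivity)
  · refine (h.sieveSum_le_of_ge hN a).trans ?_
    gcongr
    · linarith
    · exact le_add_of_nonneg_left (by positivity)
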